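/- Let $\theta$ be an inner function, let $K_\theta = H^2\ominus\theta H^2\subset L^2(\mathbb T)$, and assume that $\dim K_\theta=\infty$ (equivalently, $\theta$ is not a finite Blaschke product). Let $P_\theta$ be the orthogonal projection of $L^2(\mathbb T)$ onto $K_\theta$. A bounded operator $A$ on $K_\theta$ is called a truncated Toeplitz operator if there is $\phi\in L^2(\mathbb T)$ with $Af=P_\theta(\phi f)$ for all $f\in K_\theta\cap L^\infty$. For $\lambda$ in the unit disk $\mathbb D$ put $$k_\lambda=\frac{1-\overline{\theta(\lambda)}\,\theta}{1-\bar\lambda z},\qquad \tilde k_\lambda=\frac{\theta-\theta(\lambda)}{z-\lambda},$$ and write $x\otimes y: h\mapsto (h,y)x$. For an integer $n\ge 0$ let $\Omega_n\subset\mathbb T$ be the set of points at which every $f\in K_\theta$ and its derivatives up to order $n$ have non-tangential limits. For $\lambda\in\mathbb D$ let $\mathrm D^n[\tilde k_\lambda\otimes k_\lambda]$ be the $n$-th derivative of $\lambda\mapsto\tilde k_\lambda\otimes k_\lambda$ with respect to $\lambda$, and let $\bar{\mathrm D}^n[k_\lambda\otimes\tilde k_\lambda]$ be the $n$-th derivative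 of $\lambda\mapsto k_\lambda\otimes\tilde k_\lambda$ with respect to $\bar\lambda$; for $\lambda\in\Omega_n$ let the same symbols denote the non-tangential limits at $\lambda$ of these operator-valued derivatives. Let $\mathbb D_e=\{z:|z|>1\}\cup\{\infty\}$, $\lambda^*=1/\bar\lambda$, $\infty^*=0$, and $$F(\lambda,n)=\begin{cases}\operatorname{Ran}\bar{\mathrm D}^n[k_\lambda\otimes\tilde k_\lambda], & \lambda\in\mathbb D\cup\Omega_n,\\ \operatorname{Ran}\mathrm D^n[\tilde k_{\lambda^*}\otimes k_{\lambda^*}], & \lambda\in\mathbb D_e.\end{cases}$$ Suppose that $A$ is a bounded truncated Toeplitz operator on $K_\theta$ whose range is a direct sum $$\operatorname{Ran}A=F(\lambda_1,n_1)\dotplus\cdots\dotplus F(\lambda_s,n_s),\qquad n_k\ge 0,\quad \lambda_k\in\mathbb D\cup\Omega_{n_k}\cup\mathbb D_e .$$ Then there are bounded truncated Toeplitz operators $A_1,\dots,A_s$ on $K_\theta$ such that $A=A_1+\cdots+A_s$ and $\operatorname{Ran}A_k=F(\lambda_k,n_k)$ for $k=1,\dots,s$. -/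

import Mathlib

open MeasureTheory Filter Topology
open scoped ComplexConjugate ENNReal

namespace TruncatedToeplitz

noncomputable section

/-- The unit circle, parametrized as `t ↦ exp (2 π i t)`. The coordinate function `z` is
`fourier 1`, and `fourier n` is `z ^ n`. -/
abbrev Torus : Type := UnitAddCircle

/-- Normalized Lebesgue measure on the unit circle. -/
abbrev leb : Measure Torus := AddCircle.haarAddCircle

/-- The space `L²` on the unit circle. -/
abbrev L2 : Type := Lp ℂ 2 leb

lemma fourierCoeff_eq_inner (f : L2) (n : ℤ) :
    fourierCoeff f n = inner ℂ (fourierLp 2 n : L2) f := by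
  rw [← fourierBasis_repr, fourierBasis.repr_apply_apply, coe_fourierBasis]

/-- The Hardy space `H²`, as a subspace of `L²` on the circle. -/
def hardy : Submodule ℂ L2 where
  carrier := {f | ∀ n : ℤ, n < 0 → fourierCoeff f n = 0}
  add_mem' {f g} hf hg n hn := by
    have h1 := hf n hn
    have h2 := hg n hn
    rw [fourierCoeff_eq_inner] at h1 h2 ⊢
    rw [inner_add_right, h1, h2, add_zero]
  zero_mem' n _ := by rw [fourierCoeff_eq_inner, inner_zero_right]
  smul_mem' c f hf n hn := by
    have h1 := hf n hn
    rw [fourierCoeff_eq_inner] at h1 ⊢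
    rw [inner_smul_right, h1, mul_zero]

/-- The value at the point `w` of the unit disk of (the holomorphic extension of) a function
of the Hardy space. -/
def diskValue (f : L2) (w : ℂ) : ℂ := ∑' n : ℕ, fourierCoeff f (n : ℤ) * w ^ n

/-- An inner function, given by its boundary values. -/
structure InnerFunction where
  /-- The boundary function. -/
  bdry : L2
  mem_hardy : bdry ∈ hardy
  norm_eq_one : ∀ᵐ t ∂leb, ‖bdry t‖ = 1

/-- The subspace `θ H²` of `L²`. -/
def InnerFunction.mulHardy (θ : InnerFunction) : Submodule ℂ L2 where
  carrier := {f | ∃ h ∈ hardy, f =ᵐ[leb] fun t => θ.bdry t * h t}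
  add_mem' := by
    rintro f g ⟨h, hh, hf⟩ ⟨k, hk, hg⟩
    refine ⟨h + k, hardy.add_mem hh hk, ?_⟩
    filter_upwards [hf, hg, Lp.coeFn_add f g, Lp.coeFn_add h k] with t h1 h2 h3 h4
    rw [h3, h4, Pi.add_apply, Pi.add_apply, h1, h2, mul_add]
  zero_mem' := by
    refine ⟨0, hardy.zero_mem, ?_⟩
    filter_upwards [Lp.coeFn_zero ℂ 2 leb] with t h1
    rw [h1, Pi.zero_apply, mul_zero]
  smul_mem' := by
    rintro c f ⟨h, hh, hf⟩
    refine ⟨c • h, hardy.smul_mem c hh, ?_⟩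
    filter_upwards [hf, Lp.coeFn_smul c f, Lp.coeFn_smul c h] with t h1 h2 h3
    rw [h2, h3, Pi.smul_apply, Pi.smul_apply, h1, smul_eq_mul, smul_eq_mul]
    ring

/-- The model space `K_θ = H² ⊖ θ H²`. -/
def modelSpace (θ : InnerFunction) : Submodule ℂ L2 := hardy ⊓ (θ.mulHardy)ᗮ

lemma isClosed_hardy : IsClosed (hardy : Set L2) := by
  have : (hardy : Set L2) =
      ⋂ (n : ℤ) (_ : n < 0), {f : L2 | inner ℂ (fourierLp 2 n : L2) f = 0} := by
    ext f
    simp only [Set.mem_iInter, Set.mem_ofPred_eq, ← fourierCoeff_eq_inner]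
    rfl
  rw [this]
  exact isClosed_iInter fun n => isClosed_iInter fun _ =>
    isClosed_eq (by fun_prop) continuous_const

lemma isClosed_modelSpace (θ : InnerFunction) : IsClosed (modelSpace θ : Set L2) :=
  isClosed_hardy.inter (Submodule.isClosed_orthogonal _)

instance (θ : InnerFunction) : CompleteSpace (modelSpace θ) :=
  (isClosed_modelSpace θ).completeSpace_coe

/-! ### Reproducing kernels -/

/-- The boundary function of the reproducing kernel at `w`,
`(1 - conj (θ w) θ) / (1 - conj w z)`. -/
def kernelFun (θ : InnerFunction) (w : ℂ) (t : Torus) : ℂ :=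
  (1 - conj (diskValue θ.bdry w) * θ.bdry t) / (1 - conj w * fourier 1 t)

/-- The boundary function of the conjugate kernel at `w`, `(θ - θ w) / (z - w)`. -/
def conjKernelFun (θ : InnerFunction) (w : ℂ) (t : Torus) : ℂ :=
  (θ.bdry t - diskValue θ.bdry w) / (fourier 1 t - w)

lemma norm_fourier_apply (n : ℤ) (t : Torus) : ‖fourier n t‖ = 1 := by
  rw [fourier_apply, Circle.norm_coe]

lemma den_ne_zero {w : ℂ} (hw : ‖w‖ < 1) (t : Torus) : 1 - conj w * fourier 1 t ≠ 0 := by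
  intro h
  have h1 : ‖conj w * fourier 1 t‖ = 1 := by rw [← sub_eq_zero.mp h, norm_one]
  rw [norm_mul, norm_fourier_apply, mul_one, RCLike.norm_conj] at h1
  exact hw.ne h1

lemma conjDen_ne_zero {w : ℂ} (hw : ‖w‖ < 1) (t : Torus) : (fourier 1 t : ℂ) - w ≠ 0 := by
  intro h
  have h1 := norm_fourier_apply 1 t
  rw [sub_eq_zero.mp h] at h1
  exact hw.ne h1

lemma continuous_memLp {g : Torus → ℂ} (hg : Continuous g) : MemLp g ∞ leb :=
  (BoundedContinuousFunction.mkOfCompact ⟨g, hg⟩).memLp_top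

lemma memLp_kernelFun (θ : InnerFunction) {w : ℂ} (hw : ‖w‖ < 1) :
    MemLp (kernelFun θ w) 2 leb := by
  have h1 : MemLp (fun t => (1 - conj w * fourier 1 t)⁻¹ : Torus → ℂ) ∞ leb :=
    continuous_memLp (Continuous.inv₀ (by fun_prop) (den_ne_zero hw))
  have h2 : MemLp (fun t => 1 - conj (diskValue θ.bdry w) * θ.bdry t : Torus → ℂ) 2 leb :=
    (memLp_const 1).sub ((Lp.memLp θ.bdry).const_mul _)
  exact h1.mul' h2

lemma memLp_conjKernelFun (θ : InnerFunction) {w : ℂ} (hw : ‖w‖ < 1) :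
    MemLp (conjKernelFun θ w) 2 leb := by
  have h1 : MemLp (fun t => ((fourier 1 t : ℂ) - w)⁻¹ : Torus → ℂ) ∞ leb :=
    continuous_memLp (Continuous.inv₀ (by fun_prop) (conjDen_ne_zero hw))
  have h2 : MemLp (fun t => θ.bdry t - diskValue θ.bdry w : Torus → ℂ) 2 leb :=
    (Lp.memLp θ.bdry).sub (memLp_const _)
  exact h1.mul' h2

lemma norm_fourierCoeff_le (g : Torus → ℂ) (n : ℤ) :
    ‖fourierCoeff g n‖ ≤ ∫ t, ‖g t‖ ∂leb := by
  refine (norm_integral_le_integral_norm _).trans_eq ?_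
  congr 1; ext t
  rw [norm_smul, norm_fourier_apply, one_mul]

lemma fourierCoeff_fourier_mul (g : Torus → ℂ) (n : ℤ) :
    fourierCoeff (fun t => fourier 1 t * g t) n = fourierCoeff g (n - 1) := by
  unfold fourierCoeff
  congr 1; ext t
  rw [smul_eq_mul, smul_eq_mul, ← mul_assoc, ← fourier_add]
  congr 3; ring

lemma integrable_fourier_mul {g : Torus → ℂ} (hg : Integrable g leb) :
    Integrable (fun t => fourier 1 t * g t) leb := hg.fourier_smul 1

lemma fourierCoeff_sub {f g : Torus → ℂ} (hf : Integrable f leb) (hg : Integrable g leb) (n : ℤ) :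
    fourierCoeff (fun t => f t - g t) n = fourierCoeff f n - fourierCoeff g n := by
  unfold fourierCoeff
  simp only [smul_sub]
  exact integral_sub (hf.fourier_smul _) (hg.fourier_smul _)

lemma fourierCoeff_const (c : ℂ) (n : ℤ) :
    fourierCoeff (fun _ => c : Torus → ℂ) n = if n = 0 then c else 0 := by
  have h := fourierCoeff.const_mul (fourier 0 : Torus → ℂ) c n
  rw [fourierCoeff_fourier] at h
  simp only [fourier_zero, mul_one] at h
  rw [h, Pi.single_apply]
  split_ifs <;> simp

lemma fourierCoeff_conj (g : Torus → ℂ) (n : ℤ) :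
    fourierCoeff (fun t => conj (g t)) n = conj (fourierCoeff g (-n)) := by
  unfold fourierCoeff
  rw [← integral_conj]
  congr 1; ext t
  simp [smul_eq_mul]

/-- Solving `u m - a u (m - 1) = v m` backwards for a bounded sequence `u`. -/
lemma hasSum_backward {u v : ℤ → ℂ} {a : ℂ} (ha : ‖a‖ < 1) {C : ℝ} (hu : ∀ n, ‖u n‖ ≤ C)
    (h : ∀ n, u n - a * u (n - 1) = v n) (m : ℤ) (hs : Summable fun k : ℕ => a ^ k * v (m - k)) :
    ∑' k : ℕ, a ^ k * v (m - k) = u m := by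
  have hpart : ∀ N : ℕ, ∑ k ∈ Finset.range N, a ^ k * v (m - k) = u m - a ^ N * u (m - N) := by
    intro N
    induction N with
    | zero => simp
    | succ N ih =>
      rw [Finset.sum_range_succ, ih, ← h]
      have : m - ((N + 1 : ℕ) : ℤ) = m - N - 1 := by push_cast; ring
      rw [this, pow_succ]; ring
  have hlim : Tendsto (fun N : ℕ => a ^ N * u (m - N)) atTop (𝓝 0) := by
    refine squeeze_zero_norm (a := fun N : ℕ => ‖a‖ ^ N * C) (fun N => ?_) ?_
    · rw [norm_mul, norm_pow]
      exact mul_le_mul_of_nonneg_left (hu _) (by positivity)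
    · simpa using (tendsto_pow_atTop_nhds_zero_of_lt_one (norm_nonneg a) ha).mul_const C
  refine tendsto_nhds_unique hs.hasSum.tendsto_sum_nat ?_
  simp only [hpart]
  simpa using tendsto_const_nhds.sub hlim

lemma summable_pow_mul {v : ℕ → ℂ} {a : ℂ} (ha : ‖a‖ < 1) {C : ℝ} (hv : ∀ n, ‖v n‖ ≤ C) :
    Summable fun k : ℕ => a ^ k * v k := by
  refine Summable.of_norm_bounded
    ((summable_geometric_of_lt_one (norm_nonneg a) ha).mul_right C) fun k => ?_
  rw [norm_mul, norm_pow]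
  exact mul_le_mul_of_nonneg_left (hv _) (by positivity)

/-- Fourier coefficients of `g` from those of `(1 - a z) g`. -/
lemma fourierCoeff_of_backward {g f : Torus → ℂ} (hg : Integrable g leb) {a : ℂ} (ha : ‖a‖ < 1)
    (h : ∀ᵐ t ∂leb, g t - a * (fourier 1 t * g t) = f t) (m : ℤ) :
    fourierCoeff g m = ∑' k : ℕ, a ^ k * fourierCoeff f (m - k) := by
  refine (hasSum_backward ha (norm_fourierCoeff_le g) (fun n => ?_) m
    (summable_pow_mul ha fun n => norm_fourierCoeff_le f _)).symm
  have h1 : fourierCoeff f n = fourierCoeff (fun t => g t - a * (fourier 1 t * g t)) n := by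
    unfold fourierCoeff
    refine integral_congr_ae ?_
    filter_upwards [h] with t ht
    rw [ht]
  rw [h1, fourierCoeff_sub hg ((integrable_fourier_mul hg).const_mul a),
    fourierCoeff.const_mul, fourierCoeff_fourier_mul]

/-- Fourier coefficients of `g` from those of `(z - a) g`. -/
lemma fourierCoeff_of_forward {g f : Torus → ℂ} (hg : Integrable g leb) {a : ℂ} (ha : ‖a‖ < 1)
    (h : ∀ᵐ t ∂leb, fourier 1 t * g t - a * g t = f t) (m : ℤ) :
    fourierCoeff g m = ∑' k : ℕ, a ^ k * fourierCoeff f (m + 1 + k) := by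
  have hrec : ∀ n : ℤ, fourierCoeff g (n - 1) - a * fourierCoeff g n = fourierCoeff f n := by
    intro n
    have h1 : fourierCoeff f n = fourierCoeff (fun t => fourier 1 t * g t - a * g t) n := by
      unfold fourierCoeff
      refine integral_congr_ae ?_
      filter_upwards [h] with t ht
      rw [ht]
    rw [h1, fourierCoeff_sub (integrable_fourier_mul hg) (hg.const_mul a),
      fourierCoeff.const_mul, fourierCoeff_fourier_mul]
  have := hasSum_backward (u := fun n => fourierCoeff g (-n))
    (v := fun n => fourierCoeff f (1 - n)) ha (fun n => norm_fourierCoeff_le g _)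
    (fun n => by
      have := hrec (1 - n)
      rw [show (1 - n - 1 : ℤ) = -n by ring] at this
      rw [← this, show (-(n - 1) : ℤ) = 1 - n by ring]) (-m)
    (summable_pow_mul ha fun n => norm_fourierCoeff_le f _)
  rw [neg_neg] at this
  rw [← this]
  congr 1; ext k
  congr 2; ring

lemma L2.integrable (f : L2) : Integrable f leb := (Lp.memLp f).integrable (by norm_num)

/-- A function `g` is orthogonal to `θ H²` as soon as `conj θ g` has no Fourier coefficients of
nonnegative order. -/
lemma mem_orthogonal_mulHardy (θ : InnerFunction) (g : L2)
    (hg : ∀ n : ℤ, 0 ≤ n → fourierCoeff (fun t => conj (θ.bdry t) * g t) n = 0) :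
    g ∈ (θ.mulHardy)ᗮ := by
  rw [Submodule.mem_orthogonal]
  rintro f ⟨h, hh, hf⟩
  have hθ : MemLp (fun t => conj (θ.bdry t) : Torus → ℂ) ∞ leb := by
    refine memLp_top_of_bound ?_ 1 ?_
    · exact continuous_star.comp_aestronglyMeasurable (Lp.aestronglyMeasurable θ.bdry)
    · filter_upwards [θ.norm_eq_one] with t ht
      rw [RCLike.norm_conj, ht]
  have hv : MemLp (fun t => conj (θ.bdry t) * g t) 2 leb := (Lp.memLp g).mul' hθ
  have h1 : inner ℂ f g = inner ℂ h (hv.toLp _ : L2) := by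
    rw [L2.inner_def, L2.inner_def]
    refine integral_congr_ae ?_
    filter_upwards [hf, hv.coeFn_toLp] with t h1 h2
    rw [h1, h2]
    simp only [RCLike.inner_apply', map_mul]
    ring
  rw [h1, ← (fourierBasis (T := 1)).tsum_inner_mul_inner]
  refine (tsum_congr fun n => ?_).trans tsum_zero
  rw [coe_fourierBasis, ← fourierCoeff_eq_inner]
  rcases lt_or_ge n 0 with hn | hn
  · have := hh n hn
    rw [fourierCoeff_eq_inner] at this
    rw [← inner_conj_symm, this]; simp
  · have h2 : fourierCoeff (hv.toLp _ : L2) n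
        = fourierCoeff (fun t => conj (θ.bdry t) * g t) n := by
      unfold fourierCoeff
      refine integral_congr_ae ?_
      filter_upwards [hv.coeFn_toLp] with t h2
      rw [h2]
    rw [h2, hg n hn, mul_zero]

lemma InnerFunction.conj_mul_self (θ : InnerFunction) :
    ∀ᵐ t ∂leb, conj (θ.bdry t) * θ.bdry t = 1 := by
  filter_upwards [θ.norm_eq_one] with t ht
  rw [mul_comm, Complex.mul_conj, Complex.normSq_eq_norm_sq, ht]; simp

lemma fourierCoeff_toLp_eq {g : Torus → ℂ} (hg : MemLp g 2 leb) (n : ℤ) :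
    fourierCoeff (hg.toLp g : L2) n = fourierCoeff g n := by
  unfold fourierCoeff
  refine integral_congr_ae ?_
  filter_upwards [hg.coeFn_toLp] with t h
  rw [h]

lemma integrable_conj (f : L2) : Integrable (fun t => conj (f t) : Torus → ℂ) leb := by
  refine (L2.integrable f).mono (continuous_star.comp_aestronglyMeasurable
    (Lp.aestronglyMeasurable f)) ?_
  filter_upwards with t
  rw [RCLike.norm_conj]

lemma InnerFunction.integrable_conj_mul (θ : InnerFunction) {g : Torus → ℂ}
    (hg : MemLp g 2 leb) : Integrable (fun t => conj (θ.bdry t) * g t) leb := by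
  refine (hg.integrable (by norm_num)).mono ((continuous_star.comp_aestronglyMeasurable
    (Lp.aestronglyMeasurable θ.bdry)).mul hg.aestronglyMeasurable) ?_
  filter_upwards [θ.norm_eq_one] with t ht
  rw [norm_mul, RCLike.norm_conj, ht, one_mul]

lemma fourierCoeff_congr {f g : Torus → ℂ} (h : f =ᵐ[leb] g) (n : ℤ) :
    fourierCoeff f n = fourierCoeff g n := by
  unfold fourierCoeff
  refine integral_congr_ae ?_
  filter_upwards [h] with t ht
  rw [ht]

lemma summable_diskValue (f : L2) {w : ℂ} (hw : ‖w‖ < 1) :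
    Summable fun k : ℕ => w ^ k * fourierCoeff f (k : ℤ) :=
  summable_pow_mul hw fun k => norm_fourierCoeff_le f k

lemma diskValue_eq (f : L2) (w : ℂ) :
    diskValue f w = ∑' k : ℕ, w ^ k * fourierCoeff f (k : ℤ) :=
  tsum_congr fun _ => mul_comm _ _

lemma tsum_sub_const {v : ℕ → ℂ} {a c : ℂ} (hv : Summable fun k => a ^ k * v k) :
    ∑' k : ℕ, a ^ k * (v k - if k = 0 then c else 0) = ∑' k : ℕ, a ^ k * v k - c := by
  have h : HasSum (fun k : ℕ => a ^ k * (if k = 0 then c else 0)) c := by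
    convert hasSum_ite_eq (0 : ℕ) c using 2 with k
    split_ifs with hk <;> simp [hk]
  simp only [mul_sub]
  exact (hv.hasSum.sub h).tsum_eq

/-- The kernel at a point of the disk belongs to the model space. -/
lemma kernel_mem (θ : InnerFunction) {w : ℂ} (hw : ‖w‖ < 1) :
    (memLp_kernelFun θ hw).toLp _ ∈ modelSpace θ := by
  have hw' : ‖conj w‖ < 1 := by rwa [RCLike.norm_conj]
  have hmem := memLp_kernelFun θ hw
  have hden : ∀ t, kernelFun θ w t - conj w * (fourier 1 t * kernelFun θ w t)
      = 1 - conj (diskValue θ.bdry w) * θ.bdry t := by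
    intro t
    have : (1 - conj w * fourier 1 t) * kernelFun θ w t
        = 1 - conj (diskValue θ.bdry w) * θ.bdry t := mul_div_cancel₀ _ (den_ne_zero hw t)
    linear_combination this
  refine ⟨fun n hn => ?_, mem_orthogonal_mulHardy θ _ fun n hn => ?_⟩
  · rw [fourierCoeff_toLp_eq, fourierCoeff_of_backward (hmem.integrable (by norm_num)) hw'
      (Eventually.of_forall hden)]
    refine (tsum_congr fun k => ?_).trans tsum_zero
    have hk : n - (k : ℤ) < 0 := by omega
    rw [fourierCoeff_sub (integrable_const _) ((L2.integrable θ.bdry).const_mul _),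
      fourierCoeff.const_mul, fourierCoeff_const, θ.mem_hardy _ hk, if_neg hk.ne]
    simp
  · have hae : (fun t => conj (θ.bdry t) * (hmem.toLp _ : L2) t) =ᵐ[leb]
        fun t => conj (θ.bdry t) * kernelFun θ w t := by
      filter_upwards [hmem.coeFn_toLp] with t ht
      rw [ht]
    have hae2 : ∀ᵐ t ∂leb, conj (θ.bdry t) * kernelFun θ w t
        - conj w * (fourier 1 t * (conj (θ.bdry t) * kernelFun θ w t))
        = conj (θ.bdry t) - conj (diskValue θ.bdry w) := by
      filter_upwards [θ.conj_mul_self] with t ht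
      linear_combination conj (θ.bdry t) * hden t - conj (diskValue θ.bdry w) * ht
    rw [fourierCoeff_congr hae, fourierCoeff_of_backward (θ.integrable_conj_mul hmem) hw' hae2]
    have hco : ∀ k : ℕ, fourierCoeff (fun t => conj (θ.bdry t) - conj (diskValue θ.bdry w))
        (n - k) = conj (fourierCoeff θ.bdry (k - n))
          - if n - (k : ℤ) = 0 then conj (diskValue θ.bdry w) else 0 := by
      intro k
      rw [fourierCoeff_sub (integrable_conj _) (integrable_const _), fourierCoeff_conj,
        fourierCoeff_const, neg_sub]
    simp only [hco]
    -- only the terms with `k ≥ n` survive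
    have hsum0 : ∑' k : ℕ, conj w ^ k * (conj (fourierCoeff θ.bdry k)
        - if k = 0 then conj (diskValue θ.bdry w) else 0) = 0 := by
      rw [tsum_sub_const (v := fun k : ℕ => conj (fourierCoeff θ.bdry k))
        (summable_pow_mul hw' fun k => by
          rw [RCLike.norm_conj]; exact norm_fourierCoeff_le θ.bdry k), diskValue_eq,
        Complex.conj_tsum]
      simp
    obtain ⟨N, rfl⟩ := Int.eq_ofNat_of_zero_le hn
    have hS : Summable fun k : ℕ => conj w ^ k * (conj (fourierCoeff θ.bdry (k - (N : ℤ)))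
          - if (N : ℤ) - (k : ℤ) = 0 then conj (diskValue θ.bdry w) else 0) := by
      simp only [← hco]
      exact summable_pow_mul hw' fun k => norm_fourierCoeff_le _ _
    rw [← hS.sum_add_tsum_nat_add N, Finset.sum_eq_zero, zero_add]
    · refine Eq.trans ?_ ((congrArg (conj w ^ N * ·) hsum0).trans (mul_zero _))
      simp only [← tsum_mul_left]
      refine tsum_congr fun k => ?_
      have h1 : ((k + N : ℕ) : ℤ) - N = k := by push_cast; ring
      have h2 : ((N : ℤ) - ((k + N : ℕ) : ℤ) = 0) ↔ k = 0 := by push_cast; omega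
      simp only [h1, h2, pow_add]
      ring
    · intro k hk
      rw [Finset.mem_range] at hk
      rw [θ.mem_hardy _ (by omega), if_neg (by omega)]
      simp

/-- The conjugate kernel at a point of the disk belongs to the model space. -/
lemma conjKernel_mem (θ : InnerFunction) {w : ℂ} (hw : ‖w‖ < 1) :
    (memLp_conjKernelFun θ hw).toLp _ ∈ modelSpace θ := by
  have hmem := memLp_conjKernelFun θ hw
  have hden : ∀ t, fourier 1 t * conjKernelFun θ w t - w * conjKernelFun θ w t
      = θ.bdry t - diskValue θ.bdry w := by
    intro t
    have : ((fourier 1 t : ℂ) - w) * conjKernelFun θ w t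
        = θ.bdry t - diskValue θ.bdry w := mul_div_cancel₀ _ (conjDen_ne_zero hw t)
    linear_combination this
  refine ⟨fun n hn => ?_, mem_orthogonal_mulHardy θ _ fun n hn => ?_⟩
  · rw [fourierCoeff_toLp_eq, fourierCoeff_of_forward (hmem.integrable (by norm_num)) hw
      (Eventually.of_forall hden)]
    have hco : ∀ k : ℕ, fourierCoeff (fun t => θ.bdry t - diskValue θ.bdry w)
        (n + 1 + k) = fourierCoeff θ.bdry (n + 1 + k)
          - if n + 1 + (k : ℤ) = 0 then diskValue θ.bdry w else 0 := by
      intro k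
      rw [fourierCoeff_sub (L2.integrable _) (integrable_const _), fourierCoeff_const]
    obtain ⟨N, hN⟩ := Int.eq_ofNat_of_zero_le (show 0 ≤ -(n + 1) by omega)
    obtain rfl : n = -(N : ℤ) - 1 := by omega
    have hS : Summable fun k : ℕ => w ^ k * (fourierCoeff θ.bdry (-(N : ℤ) - 1 + 1 + k)
          - if -(N : ℤ) - 1 + 1 + (k : ℤ) = 0 then diskValue θ.bdry w else 0) := by
      simp only [← hco]
      exact summable_pow_mul hw fun k => norm_fourierCoeff_le _ _
    simp only [hco]
    rw [← hS.sum_add_tsum_nat_add N, Finset.sum_eq_zero, zero_add]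
    · have hsum0 : ∑' k : ℕ, w ^ k * (fourierCoeff θ.bdry k
          - if k = 0 then diskValue θ.bdry w else 0) = 0 := by
        rw [tsum_sub_const (v := fun k : ℕ => fourierCoeff θ.bdry k)
          (summable_diskValue _ hw), diskValue_eq, sub_self]
      refine Eq.trans ?_ ((congrArg (w ^ N * ·) hsum0).trans (mul_zero _))
      simp only [← tsum_mul_left]
      refine tsum_congr fun k => ?_
      have h1 : -(N : ℤ) - 1 + 1 + ((k + N : ℕ) : ℤ) = k := by push_cast; ring
      simp only [h1, pow_add, Nat.cast_eq_zero]
      ring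
    · intro k hk
      rw [Finset.mem_range] at hk
      rw [θ.mem_hardy _ (by omega), if_neg (by omega)]
      simp
  · have hae : (fun t => conj (θ.bdry t) * (hmem.toLp _ : L2) t) =ᵐ[leb]
        fun t => conj (θ.bdry t) * conjKernelFun θ w t := by
      filter_upwards [hmem.coeFn_toLp] with t ht
      rw [ht]
    have hae2 : ∀ᵐ t ∂leb, fourier 1 t * (conj (θ.bdry t) * conjKernelFun θ w t)
        - w * (conj (θ.bdry t) * conjKernelFun θ w t)
        = 1 - diskValue θ.bdry w * conj (θ.bdry t) := by
      filter_upwards [θ.conj_mul_self] with t ht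
      linear_combination conj (θ.bdry t) * hden t + ht
    rw [fourierCoeff_congr hae, fourierCoeff_of_forward (θ.integrable_conj_mul hmem) hw hae2]
    refine (tsum_congr fun k => ?_).trans tsum_zero
    rw [fourierCoeff_sub (integrable_const _) ((integrable_conj _).const_mul _),
      fourierCoeff.const_mul, fourierCoeff_conj, fourierCoeff_const,
      θ.mem_hardy _ (by omega), if_neg (by omega)]
    simp

open scoped Classical in
/-- The reproducing kernel `k_w` of `K_θ` at a point `w` of the unit disk (and `0` elsewhere). -/
def kernel (θ : InnerFunction) (w : ℂ) : modelSpace θ :=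
  if hw : ‖w‖ < 1 then ⟨(memLp_kernelFun θ hw).toLp _, kernel_mem θ hw⟩ else 0

open scoped Classical in
/-- The conjugate kernel of `K_θ` at a point `w` of the unit disk (and `0` elsewhere). -/
def conjKernel (θ : InnerFunction) (w : ℂ) : modelSpace θ :=
  if hw : ‖w‖ < 1 then ⟨(memLp_conjKernelFun θ hw).toLp _, conjKernel_mem θ hw⟩ else 0

/-! ### Truncated Toeplitz operators -/

/-- The product of an `L²` function and an essentially bounded function, as an element of `L²`. -/
def mulBdd (φ f : L2) (hf : MemLp f ∞ leb) : L2 :=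
  (hf.mul' (Lp.memLp φ) : MemLp (fun t => φ t * f t) 2 leb).toLp _

/-- `A` is a bounded truncated Toeplitz operator on `K_θ`: there is a symbol `φ ∈ L²` such that
`A f = P_θ (φ f)` for all `f ∈ K_θ ∩ L^∞`. -/
def IsTruncatedToeplitz (θ : InnerFunction) (A : modelSpace θ →L[ℂ] modelSpace θ) : Prop :=
  ∃ φ : L2, ∀ (f : modelSpace θ) (hf : MemLp (f : L2) ∞ leb),
    A f = (modelSpace θ).orthogonalProjectionOnto (mulBdd φ (f : L2) hf)

/-! ### Nontangential limits -/

/-- The nontangential approach region of aperture `M` at the point `ζ` of the unit circle. -/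
def stolzAngle (M : ℝ) (ζ : ℂ) : Set ℂ := {w | ‖w‖ < 1 ∧ ‖ζ - w‖ < M * (1 - ‖w‖)}

/-- The filter of nontangential convergence to `ζ`: `Tendsto f (nontangential ζ) l` says that `f`
tends to `l` along every nontangential approach region at `ζ`. -/
def nontangential (ζ : ℂ) : Filter ℂ := ⨆ M : ℝ, 𝓝[stolzAngle M ζ] ζ

/-- The set `Ω_n` of the points of the unit circle at which all functions of `K_θ` and their
derivatives up to order `n` have (finite) nontangential limits. -/
def Omega (θ : InnerFunction) (n : ℕ) : Set ℂ :=
  {ζ | ‖ζ‖ = 1 ∧ ∀ f ∈ modelSpace θ, ∀ j ≤ n,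
    ∃ L : ℂ, Tendsto (iteratedDeriv j (diskValue f)) (nontangential ζ) (𝓝 L)}

/-! ### The elementary operators and their ranges -/

/-- Extension of an operator function on the disk to the points of the unit circle, by
nontangential limits in the weak operator topology. (At the points of interest the limit exists in
the operator norm as well, and the two limits are then the same operator.) -/
def boundaryExtend {θ : InnerFunction} (Ψ : ℂ → modelSpace θ →L[ℂ] modelSpace θ) (w : ℂ) :
    modelSpace θ →L[ℂ] modelSpace θ :=
  if ‖w‖ < 1 then Ψ w
  else (limUnder (nontangential w) fun μ => ContinuousLinearMapWOT.ofCLM (Ψ μ)).toCLM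

/-- The operator `D^n [k̃_w ⊗ k_w]`: the `n`-th derivative in `w` of the holomorphic function
`w ↦ k̃_w ⊗ k_w` for `w` in the disk, and the nontangential limit of that derivative
at `w ∈ Ω_n`. Here `x ⊗ y : h ↦ (h, y) x`. -/
def opD (θ : InnerFunction) (n : ℕ) (w : ℂ) : modelSpace θ →L[ℂ] modelSpace θ :=
  boundaryExtend
    (iteratedDeriv n fun μ => InnerProductSpace.rankOne ℂ (conjKernel θ μ) (kernel θ μ)) w

/-- The operator `D̄^n [k_w ⊗ k̃_w]`: the `n`-th derivative with respect to `conj w` of the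
antiholomorphic function `w ↦ k_w ⊗ k̃_w` for `w` in the disk, and the nontangential
limit of that derivative at `w ∈ Ω_n`. The derivative with respect to `conj w` is the complex
derivative at `conj w` of the holomorphic function obtained by precomposing with conjugation. -/
def opDbar (θ : InnerFunction) (n : ℕ) (w : ℂ) : modelSpace θ →L[ℂ] modelSpace θ :=
  boundaryExtend (fun μ => iteratedDeriv n
    (fun ν => InnerProductSpace.rankOne ℂ (kernel θ (conj ν)) (conjKernel θ (conj ν))) (conj μ)) w

/-- The set `𝔻 ∪ Ω_n ∪ 𝔻_e` in the Riemann sphere, where `𝔻_e = {|z| > 1} ∪ {∞}`. -/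
def admissible (θ : InnerFunction) (n : ℕ) : Set (OnePoint ℂ) :=
  (fun w : ℂ => (w : OnePoint ℂ)) '' ({w | ‖w‖ < 1} ∪ Omega θ n ∪ {w | 1 < ‖w‖}) ∪
    {OnePoint.infty}

/-- The subspace `F(w, n)`: the range of `D̄^n [k_w ⊗ k̃_w]` for `w ∈ 𝔻 ∪ Ω_n`, and the range of
`D^n [k̃_{w*} ⊗ k_{w*}]` for `w ∈ 𝔻_e`, where `w* = 1 / conj w` and `∞* = 0`. -/
def rangeSpace (θ : InnerFunction) (w : OnePoint ℂ) (n : ℕ) : Submodule ℂ (modelSpace θ) :=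
  match w with
  | OnePoint.infty => (opD θ n 0).range
  | OnePoint.some w => if ‖w‖ ≤ 1 then (opDbar θ n w).range else (opD θ n (1 / conj w)).range

end

end TruncatedToeplitz

/-!
Let `T` be the backward shift of the model space `K_θ` and let `e` be evaluation at `0`. By
Sarason's theorem `A` is a truncated Toeplitz operator if and only if it is shift invariant:
`⟪A f, g⟫ = ⟪A (T f), T g⟫` for all `f, g ∈ ker e`.

The components `B_k` of `A` along the direct sum are bounded because the `F(λ_k, n_k)` are
finite-dimensional. For fixed `f ∈ ker e` the functionals `g ↦ ⟪B_k f, g⟫ - ⟪B_k (T f), T g⟫` on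
`ker e` sum to zero. The space `F(λ_k, n_k)` is spanned by derivatives of kernels at `λ_k`, which
form a Jordan chain for a linear pencil in `T` determined by `λ_k`; so the `k`-th functional lies in
a space of dimension at most `n_k + 1` attached to `λ_k`. Since `K_θ` is infinite-dimensional, the
spaces attached to distinct points are independent. Hence every functional vanishes and every `B_k`
is shift invariant.
-/

namespace TruncatedToeplitz

noncomputable section

/-! ### Chains of functionals for an observable shift -/

section Chains

open Polynomial

variable {𝕜 V : Type*} [Field 𝕜] [AddCommGroup V] [Module 𝕜 V] {T : Module.End 𝕜 V}
  {e : Module.Dual 𝕜 V} {p q r : 𝕜 × 𝕜} {N n : ℕ} {f : V}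

/-- The vectors `f` whose first `N` coefficients `e f, e (T f), …` vanish. -/
def vanishing (T : Module.End 𝕜 V) (e : Module.Dual 𝕜 V) (N : ℕ) : Submodule 𝕜 V :=
  ⨅ i : Fin N, LinearMap.ker (e ∘ₗ T ^ (i : ℕ))

lemma mem_vanishing : f ∈ vanishing T e N ↔ ∀ i < N, e ((T ^ i) f) = 0 := by
  simp [vanishing, Fin.forall_iff]

lemma mem_vanishing_succ :
    f ∈ vanishing T e (N + 1) ↔ f ∈ vanishing T e N ∧ e ((T ^ N) f) = 0 := by
  simp only [mem_vanishing, Nat.forall_lt_succ_right]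

lemma vanishing_antitone : Antitone (vanishing T e) :=
  fun _ _ h _ hf => mem_vanishing.2 fun i hi => mem_vanishing.1 hf i (hi.trans_le h)

lemma vanishing_zero : vanishing T e 0 = ⊤ := by simp [vanishing]

lemma vanishing_one : vanishing T e 1 = LinearMap.ker e := by ext; simp [mem_vanishing]

lemma apply_mem_vanishing (hf : f ∈ vanishing T e (N + 1)) : T f ∈ vanishing T e N :=
  mem_vanishing.2 fun i hi => by
    rw [← Module.End.mul_apply, ← pow_succ]
    exact mem_vanishing.1 hf _ (by lia)

/-- A vector is determined by its coefficients `e f, e (T f), …` (observability of the linear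
system with state operator `T` and output `e`). -/
def IsObservable (T : Module.End 𝕜 V) (e : Module.Dual 𝕜 V) : Prop :=
  ∀ f, (∀ i, e ((T ^ i) f) = 0) → f = 0

lemma IsObservable.exists_apply_notMem_vanishing (h : IsObservable T e)
    (hV : ¬ FiniteDimensional 𝕜 V) (N : ℕ) :
    ∃ g ∈ vanishing T e (N + 1), e ((T ^ N) (T g)) ≠ 0 := by
  by_contra! hT
  have hstable : ∀ g ∈ vanishing T e (N + 1), T g ∈ vanishing T e (N + 1) := fun g hg =>
    mem_vanishing_succ.2 ⟨apply_mem_vanishing hg, hT g hg⟩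
  have hpow : ∀ g ∈ vanishing T e (N + 1), ∀ i, (T ^ i) g ∈ vanishing T e (N + 1) := by
    intro g hg i
    induction i with
    | zero => simpa using hg
    | succ i ih => rw [pow_succ', Module.End.mul_apply]; exact hstable _ ih
  have hbot : ∀ g ∈ vanishing T e (N + 1), g = 0 := fun g hg =>
    h g fun i => mem_vanishing.1 (hpow g hg i) 0 N.succ_pos
  let coeffs : V →ₗ[𝕜] Fin (N + 1) → 𝕜 := LinearMap.pi fun i => e ∘ₗ T ^ (i : ℕ)
  have hcoeffs : Function.Injective coeffs :=
    (injective_iff_map_eq_zero coeffs).2 fun g hg =>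
      hbot g (mem_vanishing.2 fun i hi => congrFun hg ⟨i, hi⟩)
  exact hV (FiniteDimensional.of_injective coeffs hcoeffs)

lemma IsObservable.vanishing_le_sup_map (h : IsObservable T e) (hV : ¬ FiniteDimensional 𝕜 V)
    (N : ℕ) : vanishing T e N ≤ vanishing T e (N + 1) ⊔ (vanishing T e (N + 1)).map T := by
  intro f hf
  obtain ⟨g, hg, hTg⟩ := h.exists_apply_notMem_vanishing hV N
  set c := e ((T ^ N) f) / e ((T ^ N) (T g))
  have hfg : f - T (c • g) ∈ vanishing T e (N + 1) := by
    refine mem_vanishing_succ.2 ⟨sub_mem hf ?_, ?_⟩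
    · exact apply_mem_vanishing (Submodule.smul_mem _ c hg)
    · simp [c, div_mul_cancel₀ _ hTg]
  exact Submodule.mem_sup.2 ⟨_, hfg, _, Submodule.mem_map_of_mem (Submodule.smul_mem _ c hg),
    sub_add_cancel _ _⟩

lemma aeval_mul_apply (T : Module.End 𝕜 V) (P Q : 𝕜[X]) (f : V) :
    aeval T (P * Q) f = aeval T P (aeval T Q f) := by
  rw [map_mul, Module.End.mul_apply]

/-- The linear form `p.1 X + p.2`. Up to scaling, `p` is a point of the projective line. -/
def linearForm (p : 𝕜 × 𝕜) : 𝕜[X] := C p.1 * X + C p.2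

lemma aeval_linearForm_apply (T : Module.End 𝕜 V) (p : 𝕜 × 𝕜) (f : V) :
    aeval T (linearForm p) f = p.1 • T f + p.2 • f := by
  simp [linearForm, Module.algebraMap_end_apply]

/-- The determinant of two linear forms; it vanishes if and only if they are proportional. -/
def det (p q : 𝕜 × 𝕜) : 𝕜 := p.1 * q.2 - p.2 * q.1

lemma aeval_linearForm_eq_add (T : Module.End 𝕜 V) (hpq : det p q ≠ 0) (r : 𝕜 × 𝕜) :
    aeval T (linearForm r) = (det r q / det p q) • aeval T (linearForm p) +
      (det p r / det p q) • aeval T (linearForm q) := by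
  ext f
  simp only [LinearMap.add_apply, LinearMap.smul_apply, aeval_linearForm_apply]
  match_scalars <;> field_simp <;> unfold det <;> ring

lemma IsObservable.apply_eq_zero_of_det_ne_zero (h : IsObservable T e)
    (hV : ¬ FiniteDimensional 𝕜 V) (hpq : det p q ≠ 0) {l : Module.Dual 𝕜 V}
    (hp : ∀ f ∈ vanishing T e (N + 1), l (aeval T (linearForm p) f) = 0)
    (hq : ∀ f ∈ vanishing T e (N + 1), l (aeval T (linearForm q) f) = 0) :
    ∀ f ∈ vanishing T e N, l f = 0 := by
  have hr : ∀ r : 𝕜 × 𝕜, ∀ f ∈ vanishing T e (N + 1), l (aeval T (linearForm r) f) = 0 := by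
    intro r f hf
    simp [aeval_linearForm_eq_add T hpq r, hp f hf, hq f hf]
  intro f hf
  obtain ⟨f₁, hf₁, _, ⟨f₂, hf₂, rfl⟩, rfl⟩ :=
    Submodule.mem_sup.1 (h.vanishing_le_sup_map hV N hf)
  have h₁ := hr (0, 1) f₁ hf₁
  have h₂ := hr (1, 0) f₂ hf₂
  simp only [aeval_linearForm_apply, zero_smul, one_smul, zero_add, add_zero] at h₁ h₂
  rw [map_add, h₁, h₂, add_zero]

lemma aeval_linearForm_apply_mem_vanishing (p : 𝕜 × 𝕜) (hf : f ∈ vanishing T e (N + 1)) :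
    aeval T (linearForm p) f ∈ vanishing T e N := by
  rw [aeval_linearForm_apply]
  exact add_mem (Submodule.smul_mem _ _ (apply_mem_vanishing hf))
    (Submodule.smul_mem _ _ (vanishing_antitone N.le_succ hf))

lemma aeval_prod_linearForm_apply_mem_vanishing (S : Multiset (𝕜 × 𝕜))
    (hf : f ∈ vanishing T e (N + S.card)) :
    aeval T (S.map linearForm).prod f ∈ vanishing T e N := by
  induction S using Multiset.induction_on generalizing N with
  | empty => simpa using hf
  | cons r S ih =>
    rw [Multiset.map_cons, Multiset.prod_cons, aeval_mul_apply]
    refine aeval_linearForm_apply_mem_vanishing r (ih ?_)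
    rwa [Multiset.card_cons, ← add_assoc, add_right_comm] at hf

lemma aeval_prod_linearForm_apply_mem_ker (S : Multiset (𝕜 × 𝕜))
    (hf : f ∈ vanishing T e (S.card + 1)) :
    aeval T (S.map linearForm).prod f ∈ LinearMap.ker e := by
  rw [← vanishing_one (T := T)]
  exact aeval_prod_linearForm_apply_mem_vanishing S (by rwa [add_comm])

lemma IsObservable.exists_aeval_prod_ne_zero (h : IsObservable T e)
    (hV : ¬ FiniteDimensional 𝕜 V) {l : Module.Dual 𝕜 V} (hl : l ≠ 0)
    (hp : ∀ f ∈ LinearMap.ker e, l (aeval T (linearForm p) f) = 0) (S : Multiset (𝕜 × 𝕜))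
    (hS : ∀ r ∈ S, det p r ≠ 0) :
    ∃ f ∈ vanishing T e S.card, l (aeval T (S.map linearForm).prod f) ≠ 0 := by
  induction S using Multiset.induction_on with
  | empty =>
    obtain ⟨f, hf⟩ := DFunLike.ne_iff.1 hl
    exact ⟨f, by simp [vanishing_zero], by simpa using hf⟩
  | cons r S ih =>
    rw [Multiset.forall_mem_cons] at hS
    obtain ⟨f, hf, hlf⟩ := ih hS.2
    rw [Multiset.card_cons, Multiset.map_cons, Multiset.prod_cons]
    by_contra! hr
    refine hlf (h.apply_eq_zero_of_det_ne_zero hV hS.1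
      (l := l ∘ₗ aeval T (S.map linearForm).prod) (fun g hg => ?_) (fun g hg => ?_) f hf)
    · rw [LinearMap.comp_apply, ← aeval_mul_apply, mul_comm, aeval_mul_apply]
      exact hp _ (aeval_prod_linearForm_apply_mem_ker S hg)
    · rw [LinearMap.comp_apply, ← aeval_mul_apply, mul_comm]
      exact hr g hg

/-- Functionals `x 0, …, x n` forming a Jordan chain of length `n + 1`, modulo functionals
proportional to `e`, of the transpose of the pencil spanned by `linearForm p` and
`linearForm q` in `T`: the chains of the theorem consist of derivatives of order `0, …, n`, which
accounts for the factor `j + 1`. -/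
structure IsJordanChain (T : Module.End 𝕜 V) (e : Module.Dual 𝕜 V) (p q : 𝕜 × 𝕜) (n : ℕ)
    (x : ℕ → Module.Dual 𝕜 V) : Prop where
  det_ne_zero : det p q ≠ 0
  zero_ne_zero : x 0 ≠ 0
  zero_apply : ∀ f ∈ LinearMap.ker e, x 0 (aeval T (linearForm p) f) = 0
  succ_apply : ∀ j < n, ∀ f ∈ LinearMap.ker e,
    x (j + 1) (aeval T (linearForm p) f) = (j + 1) * x j (aeval T (linearForm q) f)

namespace IsJordanChain

variable {x : ℕ → Module.Dual 𝕜 V}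

lemma succ_apply_prod (hx : IsJordanChain T e p q n x) {j : ℕ} (hj : j < n)
    {S : Multiset (𝕜 × 𝕜)} (hf : f ∈ vanishing T e (S.card + 1)) :
    x (j + 1) (aeval T ((p ::ₘ S).map linearForm).prod f) =
      (j + 1) * x j (aeval T ((q ::ₘ S).map linearForm).prod f) := by
  simp only [Multiset.map_cons, Multiset.prod_cons, aeval_mul_apply]
  exact hx.succ_apply j hj _ (aeval_prod_linearForm_apply_mem_ker S hf)

lemma apply_prod_eq_zero (hx : IsJordanChain T e p q n x) {j : ℕ} (hj : j ≤ n)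
    {S : Multiset (𝕜 × 𝕜)} (hS : Multiset.replicate (j + 1) p ≤ S)
    (hf : f ∈ vanishing T e S.card) : x j (aeval T (S.map linearForm).prod f) = 0 := by
  induction j generalizing S with
  | zero =>
    obtain ⟨S, rfl⟩ := Multiset.exists_cons_of_mem (Multiset.singleton_le.1 hS)
    rw [Multiset.map_cons, Multiset.prod_cons, aeval_mul_apply]
    exact hx.zero_apply _ (aeval_prod_linearForm_apply_mem_ker S (by simpa using hf))
  | succ j ih =>
    rw [Multiset.replicate_succ] at hS
    obtain ⟨S, rfl⟩ := Multiset.exists_cons_of_mem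
      (Multiset.mem_of_le hS (Multiset.mem_cons_self _ _))
    rw [Multiset.cons_le_cons_iff] at hS
    rw [Multiset.card_cons] at hf
    rw [hx.succ_apply_prod hj hf, ih (by lia) (hS.trans (Multiset.le_cons_self _ _)) (by simpa),
      mul_zero]

lemma apply_prod_eq_factorial_mul (hx : IsJordanChain T e p q n x) {m : ℕ} (hm : m ≤ n)
    (S : Multiset (𝕜 × 𝕜)) (hf : f ∈ vanishing T e (m + S.card)) :
    x m (aeval T ((Multiset.replicate m p + S).map linearForm).prod f) =
      m.factorial * x 0 (aeval T ((Multiset.replicate m q + S).map linearForm).prod f) := by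
  induction m generalizing S with
  | zero => simp
  | succ m ih =>
    rw [Multiset.replicate_succ, Multiset.cons_add,
      hx.succ_apply_prod hm (by simpa [add_right_comm] using hf), ← Multiset.add_cons,
      ih (by lia) _ (by simpa [add_right_comm, add_assoc] using hf), Multiset.add_cons,
      ← Multiset.cons_add, ← Multiset.replicate_succ, Nat.factorial_succ]
    push_cast
    ring

/-- The functionals on `ker e` obtained by composing combinations of `x 0, …, x n` with
`linearForm q` in `T`. By `IsJordanChain.restrict_comp_mem_cochains`, other linear forms give
nothing new. -/
def cochains (T : Module.End 𝕜 V) (e : Module.Dual 𝕜 V) (q : 𝕜 × 𝕜) (n : ℕ)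
    (x : ℕ → Module.Dual 𝕜 V) : Submodule 𝕜 (Module.Dual 𝕜 (LinearMap.ker e)) :=
  Submodule.span 𝕜 (Set.range fun j : Fin (n + 1) =>
    (LinearMap.ker e).dualRestrict (x j ∘ₗ aeval T (linearForm q)))

lemma restrict_comp_mem_cochains (hx : IsJordanChain T e p q n x) (r : 𝕜 × 𝕜)
    {y : Module.Dual 𝕜 V} (hy : y ∈ Submodule.span 𝕜 (Set.range fun j : Fin (n + 1) => x j)) :
    (LinearMap.ker e).dualRestrict (y ∘ₗ aeval T (linearForm r)) ∈ cochains T e q n x := by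
  have hq : ∀ j ≤ n, (LinearMap.ker e).dualRestrict (x j ∘ₗ aeval T (linearForm q)) ∈
      cochains T e q n x := fun j hj => Submodule.subset_span ⟨⟨j, by lia⟩, rfl⟩
  have hp : ∀ j ≤ n, (LinearMap.ker e).dualRestrict (x j ∘ₗ aeval T (linearForm p)) ∈
      cochains T e q n x := by
    rintro (_ | j) hj
    · convert zero_mem (cochains T e q n x) using 1
      ext f
      exact hx.zero_apply f f.2
    · convert (cochains T e q n x).smul_mem (j + 1 : 𝕜) (hq j (by lia)) using 1
      ext f
      exact hx.succ_apply j hj f f.2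
  have hr : ∀ j ≤ n, (LinearMap.ker e).dualRestrict (x j ∘ₗ aeval T (linearForm r)) ∈
      cochains T e q n x := by
    intro j hj
    rw [aeval_linearForm_eq_add T hx.det_ne_zero r, LinearMap.comp_add, LinearMap.comp_smul,
      LinearMap.comp_smul, map_add, map_smul, map_smul]
    exact add_mem (Submodule.smul_mem _ _ (hp j hj)) (Submodule.smul_mem _ _ (hq j hj))
  have hspan : Submodule.span 𝕜 (Set.range fun j : Fin (n + 1) => x j) ≤
      (cochains T e q n x).comap
        ((LinearMap.ker e).dualRestrict ∘ₗ (aeval T (linearForm r)).dualMap) :=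
    Submodule.span_le.2 (by rintro _ ⟨j, rfl⟩; exact hr j (by lia))
  exact hspan hy

end IsJordanChain

section Independence

variable {ι : Type*} {p q : ι → 𝕜 × 𝕜} {n : ι → ℕ} {x : ι → ℕ → Module.Dual 𝕜 V}

/-- The separating vector is `∏_{l ≠ k} p_l ^ (n_l + 1) * p_k ^ m`, evaluated at `T`, applied to a
suitable `f`. -/
lemma IsObservable.exists_separating [CharZero 𝕜] (h : IsObservable T e)
    (hV : ¬ FiniteDimensional 𝕜 V) {s : Finset ι}
    (hx : ∀ k ∈ s, IsJordanChain T e (p k) (q k) (n k) (x k))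
    {k : ι} (hk : k ∈ s) (hp : ∀ l ∈ s, l ≠ k → det (p k) (p l) ≠ 0) {m : ℕ} (hm : m ≤ n k) :
    ∃ g ∈ LinearMap.ker e,
      (∀ l ∈ s, l ≠ k → ∀ j ≤ n l, x l j (aeval T (linearForm (q l)) g) = 0) ∧
      (∀ j < m, x k j (aeval T (linearForm (q k)) g) = 0) ∧
      x k m (aeval T (linearForm (q k)) g) ≠ 0 := by
  classical
  set R : Multiset (𝕜 × 𝕜) := ∑ l ∈ s.erase k, Multiset.replicate (n l + 1) (p l)
  have hRdet : ∀ r ∈ R, det (p k) r ≠ 0 := by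
    intro r hr
    obtain ⟨l, hl, hr⟩ := Multiset.mem_sum.1 hr
    rw [Multiset.eq_of_mem_replicate hr]
    exact hp l (Finset.mem_of_mem_erase hl) (Finset.ne_of_mem_erase hl)
  obtain ⟨f, hf, hxf⟩ := h.exists_aeval_prod_ne_zero hV (hx k hk).zero_ne_zero (hx k hk).zero_apply
    (Multiset.replicate m (q k) + q k ::ₘ R) (by
      simp only [Multiset.mem_add, Multiset.mem_cons]
      rintro r (hr | rfl | hr)
      · exact Multiset.eq_of_mem_replicate hr ▸ (hx k hk).det_ne_zero
      · exact (hx k hk).det_ne_zero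
      · exact hRdet r hr)
  have hcard : f ∈ vanishing T e (m + (R.card + 1)) := by simpa [add_assoc] using hf
  have hq : ∀ r, aeval T (linearForm r)
      (aeval T ((Multiset.replicate m (p k) + R).map linearForm).prod f) =
        aeval T ((Multiset.replicate m (p k) + r ::ₘ R).map linearForm).prod f := fun r => by
    rw [← aeval_mul_apply, Multiset.add_cons, Multiset.map_cons, Multiset.prod_cons]
  refine ⟨aeval T ((Multiset.replicate m (p k) + R).map linearForm).prod f,
    aeval_prod_linearForm_apply_mem_ker _ (by simpa [add_assoc] using hcard),
    fun l hl hlk j hj => ?_, fun j hj => ?_, ?_⟩ <;> rw [hq]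
  · have hlR : Multiset.replicate (j + 1) (p l) ≤ R :=
      (Multiset.replicate_le_replicate (p l) |>.2 (by lia)).trans
        (Finset.single_le_sum_of_canonicallyOrdered
          (f := fun l => Multiset.replicate (n l + 1) (p l)) (Finset.mem_erase.2 ⟨hlk, hl⟩))
    exact (hx l hl).apply_prod_eq_zero hj
      (hlR.trans ((Multiset.le_cons_self _ _).trans (Multiset.le_add_left _ _))) (by simpa)
  · exact (hx k hk).apply_prod_eq_zero (by lia)
      ((Multiset.replicate_le_replicate _ |>.2 hj).trans (Multiset.le_add_right _ _)) (by simpa)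
  · rw [(hx k hk).apply_prod_eq_factorial_mul hm _ (by simpa)]
    exact mul_ne_zero (Nat.cast_ne_zero.2 m.factorial_ne_zero) hxf

lemma exists_forall_gt_eq_zero_of_ne_zero {M : Type*} [Zero M] {n : ℕ} {c : Fin n → M}
    (hc : c ≠ 0) : ∃ m, c m ≠ 0 ∧ ∀ j > m, c j = 0 := by
  classical
  obtain ⟨i, hi⟩ := Function.ne_iff.1 hc
  obtain ⟨m, hm, hmax⟩ :=
    (Finset.univ.filter fun j => c j ≠ 0).exists_maximal ⟨i, by simpa using hi⟩
  exact ⟨m, by simpa using hm, fun j hj => by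
    by_contra hcj
    exact hj.not_ge (hmax (by simpa using hcj) hj.le)⟩

/-- Testing on the vector which separates the last nonzero term leaves only this term. -/
lemma IsObservable.exists_sum_ne_zero [CharZero 𝕜] (h : IsObservable T e)
    (hV : ¬ FiniteDimensional 𝕜 V) {s : Finset ι}
    (hx : ∀ k ∈ s, IsJordanChain T e (p k) (q k) (n k) (x k))
    {k : ι} (hk : k ∈ s) (hp : ∀ l ∈ s, l ≠ k → det (p k) (p l) ≠ 0)
    {c : Fin (n k + 1) → 𝕜} (hc : c ≠ 0) :
    ∃ g ∈ LinearMap.ker e,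
      (∀ l ∈ s, l ≠ k → ∀ j ≤ n l, x l j (aeval T (linearForm (q l)) g) = 0) ∧
      ∑ j, c j * x k j (aeval T (linearForm (q k)) g) ≠ 0 := by
  obtain ⟨m, hcm, hm⟩ := exists_forall_gt_eq_zero_of_ne_zero hc
  obtain ⟨g, hg, hgl, hgk, hgm⟩ := h.exists_separating hV hx hk hp (Nat.lt_succ_iff.1 m.is_lt)
  refine ⟨g, hg, hgl, ?_⟩
  rw [Fintype.sum_eq_single m fun j hjm => ?_]
  · exact mul_ne_zero hcm hgm
  · rcases hjm.lt_or_gt with hj | hj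
    · rw [hgk j hj, mul_zero]
    · rw [hm j hj, zero_mul]

lemma IsObservable.linearIndependent_of_isJordanChain [CharZero 𝕜] (h : IsObservable T e)
    (hV : ¬ FiniteDimensional 𝕜 V) {p q : 𝕜 × 𝕜} {n : ℕ} {x : ℕ → Module.Dual 𝕜 V}
    (hx : IsJordanChain T e p q n x) : LinearIndependent 𝕜 fun j : Fin (n + 1) => x j := by
  rw [Fintype.linearIndependent_iff]
  intro c hcx
  by_contra! hc
  obtain ⟨g, -, -, hg⟩ := h.exists_sum_ne_zero (ι := Unit) hV (s := {()})
    (p := fun _ => p) (q := fun _ => q) (n := fun _ => n) (x := fun _ => x) (fun _ _ => hx)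
    (k := ()) (by simp) (by simp) (c := c) (Function.ne_iff.2 hc)
  exact hg (by simpa using LinearMap.congr_fun hcx (aeval T (linearForm q) g))

lemma IsObservable.iSupIndep_cochains [CharZero 𝕜] (h : IsObservable T e)
    (hV : ¬ FiniteDimensional 𝕜 V) (hx : ∀ k, IsJordanChain T e (p k) (q k) (n k) (x k))
    (hp : Pairwise fun k l => det (p k) (p l) ≠ 0) :
    iSupIndep fun k => IsJordanChain.cochains T e (q k) (n k) (x k) := by
  rw [iSupIndep_iff_finsetSum_eq_zero_imp_eq_zero]
  intro s φ hφ hsum k hk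
  choose! c hc using fun l hl => (Submodule.mem_span_range_iff_exists_fun 𝕜).1 (hφ l hl)
  have hφapply : ∀ l ∈ s, ∀ g : LinearMap.ker e,
      φ l g = ∑ j, c l j * x l j (aeval T (linearForm (q l)) g) := by
    intro l hl g
    simp [← hc l hl]
  suffices hck : c k = 0 by simp [← hc k hk, hck]
  by_contra hck
  obtain ⟨g, hg, hgl, hgk⟩ := h.exists_sum_ne_zero hV (fun l _ => hx l) hk
    (fun l _ hlk => hp hlk.symm) hck
  have hother : ∀ l ∈ s, l ≠ k → φ l ⟨g, hg⟩ = 0 := fun l hl hlk => by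
    rw [hφapply l hl]
    exact Finset.sum_eq_zero fun j _ => by rw [hgl l hl hlk j (by lia), mul_zero]
  refine hgk ?_
  rw [← hφapply k hk ⟨g, hg⟩, ← Finset.sum_eq_single k hother fun hks => absurd hk hks,
    ← LinearMap.sum_apply, hsum, LinearMap.zero_apply]

lemma IsObservable.apply_eq_apply_of_sum_eq [Fintype ι] [CharZero 𝕜] (h : IsObservable T e)
    (hV : ¬ FiniteDimensional 𝕜 V) (hx : ∀ k, IsJordanChain T e (p k) (q k) (n k) (x k))
    (hp : Pairwise fun k l => det (p k) (p l) ≠ 0) {y z : ι → Module.Dual 𝕜 V}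
    (hy : ∀ k, y k ∈ Submodule.span 𝕜 (Set.range fun j : Fin (n k + 1) => x k j))
    (hz : ∀ k, z k ∈ Submodule.span 𝕜 (Set.range fun j : Fin (n k + 1) => x k j))
    (hyz : ∀ g ∈ LinearMap.ker e, ∑ k, y k g = ∑ k, z k (T g)) (k : ι) :
    ∀ g ∈ LinearMap.ker e, y k g = z k (T g) := by
  set Φ : 𝕜 × 𝕜 → Module.Dual 𝕜 V →ₗ[𝕜] Module.Dual 𝕜 (LinearMap.ker e) := fun r =>
    (LinearMap.ker e).dualRestrict ∘ₗ (aeval T (linearForm r)).dualMap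
  have hΦ : ∀ k, Φ (0, 1) (y k) = Φ (1, 0) (z k) := fun k =>
    (iSupIndep_iff_finsetSum_eq_imp_eq _).1 (h.iSupIndep_cochains hV hx hp) Finset.univ
      (fun k => Φ (0, 1) (y k)) (fun k => Φ (1, 0) (z k))
      (fun k _ => ⟨(hx k).restrict_comp_mem_cochains _ (hy k),
        (hx k).restrict_comp_mem_cochains _ (hz k)⟩)
      (by ext g; simpa [Φ, aeval_linearForm_apply] using hyz g g.2) k (Finset.mem_univ k)
  intro g hg
  simpa [Φ, aeval_linearForm_apply] using LinearMap.congr_fun (hΦ k) ⟨g, hg⟩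

end Independence

end Chains

/-! ### The backward shift and the conjugation of the model space -/

lemma conj_fourier_one (t : Torus) : conj (fourier 1 t : ℂ) = fourier (-1) t := by
  rw [fourier_neg]

lemma fourier_neg_one_mul (t : Torus) : (fourier (-1) t : ℂ) * fourier 1 t = 1 := by
  rw [← fourier_add]; simp

lemma conj_fourier_mul_self (t : Torus) : conj (fourier 1 t : ℂ) * fourier 1 t = 1 := by
  rw [conj_fourier_one, fourier_neg_one_mul]

lemma L2.ext_fourierCoeff {f g : L2} (h : ∀ n, fourierCoeff f n = fourierCoeff g n) : f = g := by
  apply (fourierBasis (T := 1)).repr.injective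
  ext n
  rw [fourierBasis_repr, fourierBasis_repr, h]

lemma coeFn_fourierLp_zero : (fourierLp 2 0 : L2) =ᵐ[leb] fun _ => (1 : ℂ) := by
  filter_upwards [coeFn_fourierLp (T := 1) 2 0] with t h
  rw [h, fourier_zero]

lemma fourierLp_mem_hardy (n : ℕ) : (fourierLp 2 (n : ℤ) : L2) ∈ hardy := by
  intro m hm
  rw [fourierCoeff_congr (coeFn_fourierLp (T := 1) 2 (n : ℤ)), fourierCoeff_fourier,
    Pi.single_apply, if_neg (by lia)]

lemma inner_eq_integral (f g : L2) : inner ℂ f g = ∫ t, conj (f t) * g t ∂leb := by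
  rw [L2.inner_def]
  simp only [RCLike.inner_apply']

lemma integrable_conj_mul (f g : L2) : Integrable (fun t => conj (f t) * g t) leb := by
  simpa only [RCLike.inner_apply'] using L2.integrable_inner (𝕜 := ℂ) f g

/-- Multiplication by an essentially bounded function, as an operator on `L²`. -/
def mulLinfty (u : Lp ℂ ∞ leb) : L2 →L[ℂ] L2 :=
  (ContinuousLinearMap.mul ℂ ℂ).holderL leb ∞ 2 2 u

lemma coeFn_mulLinfty (u : Lp ℂ ∞ leb) (f : L2) : mulLinfty u f =ᵐ[leb] fun t => u t * f t :=
  (ContinuousLinearMap.mul ℂ ℂ).coeFn_holder u f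

/-- Multiplication by `z ^ n`, as an operator on `L²`. -/
def mulFourier (n : ℤ) : L2 →L[ℂ] L2 := mulLinfty (fourierLp ∞ n)

lemma coeFn_mulFourier (n : ℤ) (f : L2) :
    mulFourier n f =ᵐ[leb] fun t => fourier n t * f t := by
  filter_upwards [coeFn_mulLinfty (fourierLp ∞ n) f, coeFn_fourierLp (T := 1) ∞ n] with t h h'
  rw [mulFourier, h, h']

lemma fourierCoeff_mulFourier_one (f : L2) (n : ℤ) :
    fourierCoeff (mulFourier 1 f) n = fourierCoeff f (n - 1) := by
  rw [fourierCoeff_congr (coeFn_mulFourier 1 f), fourierCoeff_fourier_mul]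

variable {θ : InnerFunction}

lemma InnerFunction.aestronglyMeasurable (θ : InnerFunction) :
    AEStronglyMeasurable θ.bdry leb :=
  Lp.aestronglyMeasurable θ.bdry

lemma InnerFunction.memLp_top (θ : InnerFunction) : MemLp θ.bdry ∞ leb :=
  memLp_top_of_bound θ.aestronglyMeasurable 1 (θ.norm_eq_one.mono fun _ h => h.le)

/-- Multiplication by an inner function, as an operator on `L²`. -/
def InnerFunction.mulL2 (θ : InnerFunction) : L2 →L[ℂ] L2 :=
  mulLinfty (θ.memLp_top.toLp θ.bdry)

lemma InnerFunction.coeFn_mulL2 (θ : InnerFunction) (f : L2) :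
    θ.mulL2 f =ᵐ[leb] fun t => θ.bdry t * f t := by
  refine (coeFn_mulLinfty _ f).trans ?_
  filter_upwards [θ.memLp_top.coeFn_toLp] with t h
  rw [h]

lemma mem_modelSpace_iff {f : L2} : f ∈ modelSpace θ ↔ f ∈ hardy ∧
    ∀ n : ℤ, 0 ≤ n → fourierCoeff (fun t => conj (θ.bdry t) * f t) n = 0 := by
  refine ⟨fun hf => ⟨hf.1, fun n hn => ?_⟩, fun hf => ⟨hf.1, mem_orthogonal_mulHardy θ f hf.2⟩⟩
  lift n to ℕ using hn
  have horth := (Submodule.mem_orthogonal _ _).mp hf.2 (θ.mulL2 (fourierLp 2 (n : ℤ)))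
    ⟨_, fourierLp_mem_hardy n, θ.coeFn_mulL2 _⟩
  rw [inner_eq_integral] at horth
  rw [← horth]
  refine integral_congr_ae ?_
  filter_upwards [θ.coeFn_mulL2 (fourierLp 2 (n : ℤ)), coeFn_fourierLp (T := 1) 2 (n : ℤ)]
    with t hθ hn
  rw [hθ, hn, map_mul, smul_eq_mul, fourier_neg]
  ring

/-- The backward shift of `L²`, `f ↦ (f - f̂(0)) / z`. -/
def backwardShiftL2 : L2 →L[ℂ] L2 :=
  (mulFourier (-1)).comp (ContinuousLinearMap.id ℂ L2 -
    (innerSL ℂ (fourierLp 2 0 : L2)).smulRight (fourierLp 2 0 : L2))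

lemma backwardShiftL2_apply (f : L2) :
    backwardShiftL2 f = mulFourier (-1) (f - fourierCoeff f 0 • (fourierLp 2 0 : L2)) := by
  rw [fourierCoeff_eq_inner]; rfl

lemma coeFn_backwardShiftL2 (f : L2) : backwardShiftL2 f =ᵐ[leb]
    fun t => fourier (-1) t * (f t - fourierCoeff f 0) := by
  rw [backwardShiftL2_apply]
  filter_upwards [coeFn_mulFourier (-1) (f - fourierCoeff f 0 • (fourierLp 2 0 : L2)),
    Lp.coeFn_sub f (fourierCoeff f 0 • (fourierLp 2 0 : L2)),
    Lp.coeFn_smul (fourierCoeff f 0) (fourierLp 2 0 : L2), coeFn_fourierLp_zero]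
    with t hmul hsub hsmul hone
  rw [hmul, hsub, Pi.sub_apply, hsmul, Pi.smul_apply, hone, smul_eq_mul, mul_one]

lemma fourierCoeff_backwardShiftL2 (f : L2) (n : ℤ) :
    fourierCoeff (backwardShiftL2 f) n =
      fourierCoeff f (n + 1) - if n + 1 = 0 then fourierCoeff f 0 else 0 := by
  have hshift := fourierCoeff_fourier_mul (backwardShiftL2 f) (n + 1)
  rw [add_sub_cancel_right] at hshift
  rw [← hshift, ← fourierCoeff_const, ← fourierCoeff_sub (L2.integrable f) (integrable_const _)]
  refine fourierCoeff_congr ?_ _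
  filter_upwards [coeFn_backwardShiftL2 f] with t h
  rw [h, ← mul_assoc, mul_comm (fourier 1 t : ℂ), fourier_neg_one_mul, one_mul]

lemma backwardShiftL2_mem {f : L2} (hf : f ∈ modelSpace θ) :
    backwardShiftL2 f ∈ modelSpace θ := by
  rw [mem_modelSpace_iff] at hf ⊢
  refine ⟨fun n hn => ?_, fun n hn => ?_⟩
  · rw [fourierCoeff_backwardShiftL2]
    rcases eq_or_ne (n + 1) 0 with h | h
    · rw [if_pos h, h, sub_self]
    · rw [if_neg h, hf.1 _ (by lia), sub_zero]
  · have hshift :=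
      fourierCoeff_fourier_mul (fun t => conj (θ.bdry t) * backwardShiftL2 f t) (n + 1)
    rw [add_sub_cancel_right] at hshift
    have hae : (fun t => fourier 1 t * (conj (θ.bdry t) * backwardShiftL2 f t)) =ᵐ[leb]
        fun t => conj (θ.bdry t) * f t - fourierCoeff f 0 * conj (θ.bdry t) := by
      filter_upwards [coeFn_backwardShiftL2 f] with t h
      rw [h]
      linear_combination conj (θ.bdry t) * (f t - fourierCoeff f 0) * fourier_neg_one_mul t
    rw [← hshift, fourierCoeff_congr hae, fourierCoeff_sub (θ.integrable_conj_mul (Lp.memLp f))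
      ((integrable_conj _).const_mul _), fourierCoeff.const_mul, fourierCoeff_conj,
      hf.2 _ (by lia), θ.mem_hardy _ (by lia), map_zero, mul_zero, sub_zero]

/-- The backward shift of the model space. -/
def backwardShift (θ : InnerFunction) : modelSpace θ →L[ℂ] modelSpace θ :=
  (backwardShiftL2.comp (modelSpace θ).subtypeL).codRestrict _
    fun f => backwardShiftL2_mem f.2

lemma coe_backwardShift (f : modelSpace θ) :
    (backwardShift θ f : L2) = backwardShiftL2 f := rfl

/-- Evaluation of the functions of the model space at the origin. -/
def evalZero (θ : InnerFunction) : modelSpace θ →L[ℂ] ℂ :=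
  (innerSL ℂ (fourierLp 2 0 : L2)).comp (modelSpace θ).subtypeL

lemma evalZero_apply (f : modelSpace θ) : evalZero θ f = fourierCoeff (f : L2) 0 := by
  rw [fourierCoeff_eq_inner]; rfl

lemma fourierCoeff_backwardShift (f : modelSpace θ) (n : ℕ) :
    fourierCoeff (backwardShift θ f : L2) n = fourierCoeff (f : L2) ((n + 1 : ℕ) : ℤ) := by
  rw [coe_backwardShift, fourierCoeff_backwardShiftL2, if_neg (by lia), sub_zero, Nat.cast_succ]

lemma fourierCoeff_backwardShift_pow (f : modelSpace θ) (m n : ℕ) :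
    fourierCoeff ((backwardShift θ ^ m) f : L2) n = fourierCoeff (f : L2) ((n + m : ℕ) : ℤ) := by
  induction m generalizing n with
  | zero => simp
  | succ m ih =>
    rw [pow_succ', mul_apply_eq_comp, fourierCoeff_backwardShift, ih, Nat.succ_add_eq_add_succ]

lemma evalZero_backwardShift_pow (f : modelSpace θ) (m : ℕ) :
    evalZero θ ((backwardShift θ ^ m) f) = fourierCoeff (f : L2) (m : ℤ) := by
  rw [evalZero_apply]
  simpa using fourierCoeff_backwardShift_pow f m 0

lemma modelSpace_ext {f g : modelSpace θ}
    (h : ∀ n : ℕ, fourierCoeff (f : L2) n = fourierCoeff (g : L2) n) : f = g := by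
  refine Subtype.ext (L2.ext_fourierCoeff fun n => ?_)
  rcases lt_or_ge n 0 with hn | hn
  · rw [f.2.1 n hn, g.2.1 n hn]
  · lift n to ℕ using hn
    exact h n

lemma eq_zero_of_evalZero_pow {f : modelSpace θ}
    (h : ∀ m : ℕ, evalZero θ ((backwardShift θ ^ m) f) = 0) : f = 0 := by
  refine modelSpace_ext fun n => ?_
  rw [← evalZero_backwardShift_pow, h, Submodule.coe_zero, fourierCoeff_eq_inner, inner_zero_right]

lemma isObservable_backwardShift (θ : InnerFunction) :
    IsObservable (backwardShift θ : modelSpace θ →ₗ[ℂ] modelSpace θ)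
      (evalZero θ : modelSpace θ →ₗ[ℂ] ℂ) := by
  intro f hf
  refine eq_zero_of_evalZero_pow fun m => ?_
  have hfm := hf m
  rwa [← ContinuousLinearMap.toLinearMap_pow] at hfm

lemma hasSum_norm_sq_fourierCoeff {f : L2} (hf : f ∈ hardy) :
    HasSum (fun n : ℕ => ‖fourierCoeff f (n : ℤ)‖ ^ 2) (‖f‖ ^ 2) := by
  have hint : HasSum (fun n : ℤ => ‖fourierCoeff f n‖ ^ 2) (‖f‖ ^ 2) := by
    have hparseval := lp.hasSum_norm (p := 2) (by norm_num) ((fourierBasis (T := 1)).repr f)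
    rw [LinearIsometryEquiv.norm_map] at hparseval
    simpa [fourierBasis_repr] using hparseval
  refine (Nat.cast_injective.hasSum_iff fun n hn => ?_).mpr hint
  rw [hf n (not_le.1 fun h => hn (Int.eq_ofNat_of_zero_le h |>.imp fun _ => Eq.symm)), norm_zero,
    zero_pow two_ne_zero]

lemma tendsto_backwardShift_pow (f : modelSpace θ) :
    Tendsto (fun N => (backwardShift θ ^ N) f) atTop (𝓝 0) := by
  have hnorm : ∀ N, ‖(backwardShift θ ^ N) f‖ ^ 2
      = ∑' n : ℕ, ‖fourierCoeff (f : L2) ((n + N : ℕ) : ℤ)‖ ^ 2 := by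
    intro N
    simp only [← fourierCoeff_backwardShift_pow]
    exact (hasSum_norm_sq_fourierCoeff ((backwardShift θ ^ N) f).2.1).tsum_eq.symm
  have hsq : Tendsto (fun N => ‖(backwardShift θ ^ N) f‖ ^ 2) atTop (𝓝 0) := by
    simp only [hnorm]
    exact tendsto_sum_nat_add fun n : ℕ => ‖fourierCoeff (f : L2) (n : ℤ)‖ ^ 2
  rw [tendsto_zero_iff_norm_tendsto_zero]
  simpa using hsq.sqrt

/-- The conjugation `f ↦ θ * conj (z f)` of `L²`. -/
def conjugationL2 (θ : InnerFunction) : L2 →L⋆[ℂ] L2 :=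
  θ.mulL2.comp (((starL ℂ : ℂ ≃L⋆[ℂ] ℂ) : ℂ →L⋆[ℂ] ℂ).compLpL 2 leb |>.comp (mulFourier 1))

lemma coeFn_conjugationL2 (f : L2) :
    conjugationL2 θ f =ᵐ[leb] fun t => θ.bdry t * conj (fourier 1 t * f t) := by
  filter_upwards [θ.coeFn_mulL2 (((starL ℂ : ℂ ≃L⋆[ℂ] ℂ) : ℂ →L⋆[ℂ] ℂ).compLpL 2 leb
      (mulFourier 1 f)),
    ((starL ℂ : ℂ ≃L⋆[ℂ] ℂ) : ℂ →L⋆[ℂ] ℂ).coeFn_compLpL (p := 2) (μ := leb) (mulFourier 1 f),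
    coeFn_mulFourier 1 f] with t hθ hconj hz
  rw [hz] at hconj
  exact hθ.trans (congrArg (θ.bdry t * ·) hconj)

lemma conjugationL2_mem {f : L2} (hf : f ∈ modelSpace θ) :
    conjugationL2 θ f ∈ modelSpace θ := by
  rw [mem_modelSpace_iff] at hf ⊢
  refine ⟨fun n hn => ?_, fun n hn => ?_⟩
  · have hae : conjugationL2 θ f =ᵐ[leb]
        fun t => conj (fourier 1 t * (conj (θ.bdry t) * f t)) := by
      filter_upwards [coeFn_conjugationL2 f] with t h
      rw [h, map_mul, map_mul, map_mul, Complex.conj_conj]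
      ring
    rw [fourierCoeff_congr hae,
      fourierCoeff_conj (fun t => fourier 1 t * (conj (θ.bdry t) * f t)),
      fourierCoeff_fourier_mul (fun t => conj (θ.bdry t) * f t), hf.2 _ (by lia), map_zero]
  · have hae : (fun t => conj (θ.bdry t) * conjugationL2 θ f t) =ᵐ[leb]
        fun t => conj (fourier 1 t * f t) := by
      filter_upwards [coeFn_conjugationL2 f, θ.conj_mul_self] with t h h'
      rw [h, ← mul_assoc, h', one_mul]
    rw [fourierCoeff_congr hae, fourierCoeff_conj (fun t => fourier 1 t * f t),
      fourierCoeff_fourier_mul, hf.1 _ (by lia), map_zero]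

/-- The conjugation `f ↦ θ * conj (z f)` of the model space. -/
def conjugation (θ : InnerFunction) : modelSpace θ →L⋆[ℂ] modelSpace θ :=
  ((conjugationL2 θ).comp (modelSpace θ).subtypeL).codRestrict _
    fun f => conjugationL2_mem f.2

lemma coeFn_conjugation (f : modelSpace θ) :
    (conjugation θ f : L2) =ᵐ[leb] fun t => θ.bdry t * conj (fourier 1 t * (f : L2) t) :=
  coeFn_conjugationL2 (f : L2)

lemma conjugation_conjugation (f : modelSpace θ) : conjugation θ (conjugation θ f) = f := by
  refine Subtype.ext (Lp.ext ?_)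
  filter_upwards [coeFn_conjugation (conjugation θ f), coeFn_conjugation f,
    θ.conj_mul_self] with t h₂ h₁ hθ
  rw [h₂, h₁]
  simp only [map_mul, Complex.conj_conj]
  linear_combination (f : L2) t * conj (θ.bdry t) * θ.bdry t * conj_fourier_mul_self t
    + (f : L2) t * hθ

lemma inner_conjugation_conjugation (f g : modelSpace θ) :
    inner ℂ (conjugation θ f) (conjugation θ g) = inner ℂ g f := by
  rw [Submodule.coe_inner, Submodule.coe_inner, inner_eq_integral, inner_eq_integral]
  refine integral_congr_ae ?_
  filter_upwards [coeFn_conjugation f, coeFn_conjugation g, θ.conj_mul_self] with t hf hg hθ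
  rw [hf, hg]
  simp only [map_mul, Complex.conj_conj]
  linear_combination conj ((g : L2) t) * (f : L2) t * conj (θ.bdry t) * θ.bdry t *
    conj_fourier_mul_self t + conj ((g : L2) t) * (f : L2) t * hθ

lemma inner_conjugation_left (f g : modelSpace θ) :
    inner ℂ (conjugation θ f) g = inner ℂ (conjugation θ g) f := by
  rw [← inner_conjugation_conjugation, conjugation_conjugation]

lemma coeFn_backwardShift_of_evalZero {f : modelSpace θ} (hf : evalZero θ f = 0) :
    (backwardShift θ f : L2) =ᵐ[leb] fun t => fourier (-1) t * (f : L2) t := by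
  rw [evalZero_apply] at hf
  filter_upwards [coeFn_backwardShiftL2 f] with t h
  rw [coe_backwardShift, h, hf, sub_zero]

lemma coeFn_conjugation_backwardShift {f : modelSpace θ} (hf : evalZero θ f = 0) :
    (conjugation θ (backwardShift θ f) : L2) =ᵐ[leb]
      fun t => fourier 1 t * (conjugation θ f : L2) t := by
  filter_upwards [coeFn_conjugation (backwardShift θ f), coeFn_conjugation f,
    coeFn_backwardShift_of_evalZero hf] with t hCT hC hT
  rw [hCT, hC, hT, ← conj_fourier_one]
  simp only [map_mul, Complex.conj_conj]
  ring

lemma evalZero_conjugation_backwardShift {f : modelSpace θ} (hf : evalZero θ f = 0) :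
    evalZero θ (conjugation θ (backwardShift θ f)) = 0 := by
  rw [evalZero_apply, fourierCoeff_congr (coeFn_conjugation_backwardShift hf),
    fourierCoeff_fourier_mul]
  exact (conjugation θ f).2.1 _ (by norm_num)

lemma backwardShift_conjugation_backwardShift {f : modelSpace θ} (hf : evalZero θ f = 0) :
    backwardShift θ (conjugation θ (backwardShift θ f)) = conjugation θ f := by
  refine Subtype.ext (Lp.ext ?_)
  filter_upwards [coeFn_backwardShift_of_evalZero (evalZero_conjugation_backwardShift hf),
    coeFn_conjugation_backwardShift hf] with t hT hCT
  rw [hT, hCT, ← mul_assoc, fourier_neg_one_mul, one_mul]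

/-! ### Reproducing kernels -/

lemma integral_eq_fourierCoeff_zero (g : Torus → ℂ) : ∫ t, g t ∂leb = fourierCoeff g 0 := by
  simp [fourierCoeff]

lemma coeFn_kernel {w : ℂ} (hw : ‖w‖ < 1) : (kernel θ w : L2) =ᵐ[leb] kernelFun θ w := by
  rw [kernel, dif_pos hw]
  exact (memLp_kernelFun θ hw).coeFn_toLp

lemma coeFn_conjKernel {w : ℂ} (hw : ‖w‖ < 1) :
    (conjKernel θ w : L2) =ᵐ[leb] conjKernelFun θ w := by
  rw [conjKernel, dif_pos hw]
  exact (memLp_conjKernelFun θ hw).coeFn_toLp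

lemma conj_kernelFun_mul {w : ℂ} (hw : ‖w‖ < 1) (t : Torus) :
    (1 - w * fourier (-1) t) * conj (kernelFun θ w t) =
      1 - diskValue θ.bdry w * conj (θ.bdry t) := by
  have hmul : (1 - conj w * fourier 1 t) * kernelFun θ w t =
      1 - conj (diskValue θ.bdry w) * θ.bdry t := mul_div_cancel₀ _ (den_ne_zero hw t)
  simpa only [map_mul, map_sub, map_one, Complex.conj_conj, conj_fourier_one] using
    congrArg conj hmul

lemma conjugation_kernel (θ : InnerFunction) (w : ℂ) :
    conjugation θ (kernel θ w) = conjKernel θ w := by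
  by_cases hw : ‖w‖ < 1
  · refine Subtype.ext (Lp.ext ?_)
    filter_upwards [coeFn_conjugation (kernel θ w), coeFn_kernel hw, coeFn_conjKernel hw,
      θ.conj_mul_self] with t hconj hker hconjKer hθ
    rw [hconj, hker, hconjKer, conjKernelFun, eq_div_iff (conjDen_ne_zero hw t), map_mul,
      conj_fourier_one]
    linear_combination (θ.bdry t) * conj_kernelFun_mul hw t
      + θ.bdry t * conj (kernelFun θ w t) * fourier_neg_one_mul t
      - diskValue θ.bdry w * hθ
  · rw [kernel, conjKernel, dif_neg hw, dif_neg hw, map_zero]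

lemma inner_kernel {w : ℂ} (hw : ‖w‖ < 1) (f : modelSpace θ) :
    inner ℂ (kernel θ w) f = w * inner ℂ (kernel θ w) (backwardShift θ f) + evalZero θ f := by
  rw [← sub_eq_iff_eq_add']
  set c := fourierCoeff (f : L2) 0 with hc
  set k := (kernel θ w : L2)
  have hpointwise : (fun t => conj (k t) * (f : L2) t
      - w * (conj (k t) * (backwardShift θ f : L2) t)) =ᵐ[leb]
      fun t => ((f : L2) t - diskValue θ.bdry w * (conj (θ.bdry t) * (f : L2) t))
        + w * c * conj (mulFourier 1 k t) := by
    filter_upwards [coeFn_kernel hw, coeFn_backwardShiftL2 (f : L2), coeFn_mulFourier 1 k]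
      with t hker hshift hmul
    rw [coe_backwardShift, hshift, hmul, hker, ← hc, map_mul, conj_fourier_one]
    linear_combination (f : L2) t * conj_kernelFun_mul hw t
  have hθf : Integrable (fun t => conj (θ.bdry t) * (f : L2) t) leb :=
    θ.integrable_conj_mul (Lp.memLp (f : L2))
  have hdiff : Integrable (fun t => (f : L2) t
      - diskValue θ.bdry w * (conj (θ.bdry t) * (f : L2) t)) leb :=
    (L2.integrable _).sub (hθf.const_mul _)
  calc inner ℂ (kernel θ w) f - w * inner ℂ (kernel θ w) (backwardShift θ f)
      = ∫ t, conj (k t) * (f : L2) t - w * (conj (k t) * (backwardShift θ f : L2) t) ∂leb := by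
        rw [Submodule.coe_inner, Submodule.coe_inner, inner_eq_integral, inner_eq_integral,
          integral_sub (integrable_conj_mul _ _) ((integrable_conj_mul _ _).const_mul w),
          integral_const_mul]
    _ = (c - diskValue θ.bdry w * fourierCoeff (fun t => conj (θ.bdry t) * (f : L2) t) 0)
          + w * c * conj (fourierCoeff k (-1)) := by
        rw [integral_congr_ae hpointwise, integral_add hdiff
          ((integrable_conj _).const_mul _), integral_sub (L2.integrable _) (hθf.const_mul _),
          integral_const_mul, integral_const_mul, integral_eq_fourierCoeff_zero,
          integral_eq_fourierCoeff_zero, integral_eq_fourierCoeff_zero, fourierCoeff_conj,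
          neg_zero, fourierCoeff_mulFourier_one, zero_sub]
    _ = evalZero θ f := by
        rw [(mem_modelSpace_iff.mp f.2).2 0 le_rfl, (kernel θ w).2.1 _ (by norm_num), map_zero,
          mul_zero, mul_zero, sub_zero, add_zero, evalZero_apply]

lemma inner_kernel_zero (f : modelSpace θ) : inner ℂ (kernel θ 0) f = evalZero θ f := by
  simpa using inner_kernel (w := 0) (by simp) f

lemma inner_kernel_eq_sum {w : ℂ} (hw : ‖w‖ < 1) (f : modelSpace θ) (N : ℕ) :
    inner ℂ (kernel θ w) f = ∑ i ∈ Finset.range N, w ^ i * fourierCoeff (f : L2) (i : ℤ)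
      + w ^ N * inner ℂ (kernel θ w) ((backwardShift θ ^ N) f) := by
  induction N with
  | zero => simp
  | succ N ih =>
    rw [ih, inner_kernel hw ((backwardShift θ ^ N) f), evalZero_backwardShift_pow,
      Finset.sum_range_succ, pow_succ' (backwardShift θ), mul_apply_eq_comp]
    ring

lemma inner_kernel_eq_diskValue {w : ℂ} (hw : ‖w‖ < 1) (f : modelSpace θ) :
    inner ℂ (kernel θ w) f = diskValue (f : L2) w := by
  have hremainder : Tendsto
      (fun N => w ^ N * inner ℂ (kernel θ w) ((backwardShift θ ^ N) f)) atTop (𝓝 0) := by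
    simpa using (tendsto_pow_atTop_nhds_zero_of_norm_lt_one hw).mul
      ((tendsto_const_nhds (x := kernel θ w)).inner (𝕜 := ℂ) (tendsto_backwardShift_pow f))
  have hlim := (summable_diskValue (f : L2) hw).hasSum.tendsto_sum_nat.add hremainder
  simp only [← inner_kernel_eq_sum hw f, add_zero, ← diskValue_eq] at hlim
  exact tendsto_nhds_unique tendsto_const_nhds hlim

lemma diskValue_backwardShift (f : modelSpace θ) {w : ℂ} (hw : ‖w‖ < 1) :
    diskValue (f : L2) w = w * diskValue (backwardShift θ f : L2) w + evalZero θ f := by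
  rw [← inner_kernel_eq_diskValue hw, inner_kernel hw, inner_kernel_eq_diskValue hw]

lemma disk_mem_nhds {w : ℂ} (hw : ‖w‖ < 1) : {w : ℂ | ‖w‖ < 1} ∈ 𝓝 w :=
  (isOpen_lt continuous_norm continuous_const).mem_nhds hw

lemma hasFPowerSeriesOnBall_diskValue (f : L2) :
    HasFPowerSeriesOnBall (diskValue f)
      (.ofScalars ℂ fun n : ℕ => fourierCoeff f (n : ℤ)) 0 1 where
  r_le := by
    refine FormalMultilinearSeries.le_radius_of_bound _ (r := 1) (∫ t, ‖f t‖ ∂leb) fun n => ?_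
    rw [FormalMultilinearSeries.ofScalars_norm, NNReal.coe_one, one_pow, mul_one]
    exact norm_fourierCoeff_le f n
  r_pos := one_pos
  hasSum {w} hw := by
    have hw' : ‖w‖ < 1 := by simpa [enorm, ← NNReal.coe_lt_one] using hw
    rw [zero_add, diskValue_eq]
    simpa only [FormalMultilinearSeries.ofScalars_apply_eq, smul_eq_mul, mul_comm] using
      (summable_diskValue f hw').hasSum

lemma analyticAt_diskValue (f : L2) {w : ℂ} (hw : ‖w‖ < 1) : AnalyticAt ℂ (diskValue f) w :=
  (hasFPowerSeriesOnBall_diskValue f).analyticAt_of_mem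
    (by simpa [enorm, ← NNReal.coe_lt_one] using hw)

lemma eq_zero_of_diskValue {f : modelSpace θ}
    (h : ∀ w : ℂ, ‖w‖ < 1 → diskValue (f : L2) w = 0) : f = 0 := by
  have hseries := (hasFPowerSeriesOnBall_diskValue (f : L2)).hasFPowerSeriesAt
    |>.eq_zero_of_eventually (Filter.mem_of_superset (disk_mem_nhds (by simp)) h)
  rw [FormalMultilinearSeries.ofScalars_series_eq_zero] at hseries
  refine eq_zero_of_evalZero_pow fun m => ?_
  rw [evalZero_backwardShift_pow, congrFun hseries m, Pi.zero_apply]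

lemma norm_backwardShift_le (θ : InnerFunction) : ‖backwardShift θ‖ ≤ 1 := by
  refine ContinuousLinearMap.opNorm_le_bound _ zero_le_one fun f => ?_
  have hshift := hasSum_norm_sq_fourierCoeff (backwardShift θ f).2.1
  simp only [fourierCoeff_backwardShift] at hshift
  have hnorm := hshift.unique ((hasSum_nat_add_iff' 1).mpr (hasSum_norm_sq_fourierCoeff f.2.1))
  rw [Finset.sum_range_one] at hnorm
  rw [one_mul]
  refine le_of_sq_le_sq (hnorm.trans_le ?_) (norm_nonneg _)
  exact sub_le_self _ (by positivity)

section Resolvent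

variable {𝕜 E : Type*} [NontriviallyNormedField 𝕜] [NormedAddCommGroup E] [NormedSpace 𝕜 E]
  [CompleteSpace E] {S : E →L[𝕜] E} {ν : 𝕜}

lemma isUnit_one_sub_smul (hS : ‖S‖ ≤ 1) (hν : ‖ν‖ < 1) : IsUnit (1 - ν • S) := by
  refine isUnit_one_sub_of_norm_lt_one (R := E →L[𝕜] E) ?_
  rw [norm_smul]
  exact (mul_le_of_le_one_right (norm_nonneg ν) hS).trans_lt hν

lemma differentiableAt_inverse_one_sub_smul_apply (hS : ‖S‖ ≤ 1) (x : E) (hν : ‖ν‖ < 1) :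
    DifferentiableAt 𝕜 (fun ν : 𝕜 => Ring.inverse (1 - ν • S) x) ν := by
  have hsub : DifferentiableAt 𝕜 (fun ν : 𝕜 => 1 - ν • S) ν :=
    (differentiableAt_const _).sub (differentiableAt_id.smul_const _)
  exact ((differentiableAt_inverse (isUnit_one_sub_smul hS hν)).comp ν hsub).clm_apply
    (differentiableAt_const x)

end Resolvent

lemma norm_adjoint_backwardShift_le (θ : InnerFunction) :
    ‖ContinuousLinearMap.adjoint (backwardShift θ)‖ ≤ 1 :=
  (LinearIsometryEquiv.norm_map _ _).trans_le (norm_backwardShift_le θ)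

lemma kernel_conj_eq_inverse {ν : ℂ} (hν : ‖ν‖ < 1) :
    kernel θ (conj ν) =
      Ring.inverse (1 - ν • ContinuousLinearMap.adjoint (backwardShift θ)) (kernel θ 0) := by
  have hresolvent : (1 - ν • ContinuousLinearMap.adjoint (backwardShift θ)) (kernel θ (conj ν)) =
      kernel θ 0 := by
    refine ext_inner_right ℂ fun f => ?_
    rw [inner_kernel_zero, sub_apply, smul_apply, one_apply_eq_self, inner_sub_left,
      inner_smul_left, ContinuousLinearMap.adjoint_inner_left]
    linear_combination inner_kernel (by rwa [RCLike.norm_conj]) f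
  rw [← hresolvent, ← mul_apply_eq_comp, Ring.inverse_mul_cancel _
    (isUnit_one_sub_smul (norm_adjoint_backwardShift_le θ) hν), one_apply_eq_self]

lemma differentiableAt_kernel_conj {ν : ℂ} (hν : ‖ν‖ < 1) :
    DifferentiableAt ℂ (fun ν => kernel θ (conj ν)) ν := by
  refine (differentiableAt_inverse_one_sub_smul_apply (norm_adjoint_backwardShift_le θ)
    (kernel θ 0) hν).congr_of_eventuallyEq ?_
  filter_upwards [disk_mem_nhds hν] with μ hμ using kernel_conj_eq_inverse hμ

/-- The bounded functions of the model space. -/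
def boundedFunctions (θ : InnerFunction) : Submodule ℂ (modelSpace θ) where
  carrier := {f | MemLp (f : L2) ∞ leb}
  add_mem' {f g} hf hg := (hf.add hg).ae_eq (Lp.coeFn_add (f : L2) g).symm
  zero_mem' := (MemLp.zero (ε := ℂ)).ae_eq (Lp.coeFn_zero ℂ 2 leb).symm
  smul_mem' c f hf := (hf.const_smul c).ae_eq (Lp.coeFn_smul c (f : L2)).symm

lemma mem_boundedFunctions {f : modelSpace θ} :
    f ∈ boundedFunctions θ ↔ MemLp (f : L2) ∞ leb := Iff.rfl

lemma kernel_mem_boundedFunctions {w : ℂ} (hw : ‖w‖ < 1) : kernel θ w ∈ boundedFunctions θ := by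
  have hden : MemLp (fun t => (1 - conj w * fourier 1 t)⁻¹ : Torus → ℂ) ∞ leb :=
    continuous_memLp (Continuous.inv₀ (by fun_prop) (den_ne_zero hw))
  have hnum : MemLp (fun t => 1 - conj (diskValue θ.bdry w) * θ.bdry t : Torus → ℂ) ∞ leb :=
    (memLp_const 1).sub (θ.memLp_top.const_mul _)
  exact (hden.mul' hnum : MemLp (kernelFun θ w) ∞ leb).ae_eq (coeFn_kernel hw).symm

lemma dense_boundedFunctions : Dense (boundedFunctions θ : Set (modelSpace θ)) := by
  rw [Submodule.dense_iff_topologicalClosure_eq_top, Submodule.topologicalClosure_eq_top_iff,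
    Submodule.eq_bot_iff]
  intro f hf
  refine eq_zero_of_diskValue fun w hw => ?_
  rw [← inner_kernel_eq_diskValue hw]
  exact (Submodule.mem_orthogonal _ _).mp hf _ (kernel_mem_boundedFunctions hw)

/-! ### Shift invariance characterises truncated Toeplitz operators -/

/-- An operator `A` on the model space is shift invariant if `⟪z g, A (z f)⟫ = ⟪g, A f⟫` whenever
`f`, `g`, `z f`, `z g` belong to the model space. The condition is phrased through the backward
shift, which undoes multiplication by `z`: here `f` and `g` stand for `z f` and `z g`. -/
def ShiftInvariant (A : modelSpace θ →L[ℂ] modelSpace θ) : Prop :=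
  ∀ f g : modelSpace θ, evalZero θ f = 0 → evalZero θ g = 0 →
    inner ℂ g (A f) = inner ℂ (backwardShift θ g) (A (backwardShift θ f))

lemma coeFn_mulBdd (φ f : L2) (hf : MemLp f ∞ leb) :
    mulBdd φ f hf =ᵐ[leb] fun t => φ t * f t := MemLp.coeFn_toLp _

lemma inner_orthogonalProjectionOnto_mulBdd (φ : L2) (f g : modelSpace θ)
    (hf : MemLp (f : L2) ∞ leb) :
    inner ℂ g ((modelSpace θ).orthogonalProjectionOnto (mulBdd φ (f : L2) hf)) =
      ∫ t, conj ((g : L2) t) * (φ t * (f : L2) t) ∂leb := by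
  rw [Submodule.inner_orthogonalProjectionOnto_eq_of_mem_left, inner_eq_integral]
  refine integral_congr_ae ?_
  filter_upwards [coeFn_mulBdd φ f hf] with t h
  rw [h]

lemma backwardShift_mem_boundedFunctions {f : modelSpace θ} (hf : f ∈ boundedFunctions θ)
    (hf₀ : evalZero θ f = 0) : backwardShift θ f ∈ boundedFunctions θ :=
  (hf.mul' (continuous_memLp (fourier (-1)).continuous) :
    MemLp (fun t => fourier (-1) t * (f : L2) t) ∞ leb).ae_eq
      (coeFn_backwardShift_of_evalZero hf₀).symm

lemma exists_seq_boundedFunctions {f : modelSpace θ} (hf : evalZero θ f = 0) :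
    ∃ d : ℕ → modelSpace θ, (∀ n, d n ∈ boundedFunctions θ) ∧ (∀ n, evalZero θ (d n) = 0) ∧
      Tendsto d atTop (𝓝 f) := by
  obtain ⟨d, hd, hlim⟩ := mem_closure_iff_seq_limit.mp (dense_boundedFunctions f)
  set c := evalZero θ (kernel θ 0)
  refine ⟨fun n => d n - (evalZero θ (d n) * c⁻¹) • kernel θ 0, fun n => sub_mem (hd n)
    (Submodule.smul_mem _ _ (kernel_mem_boundedFunctions (by simp))), fun n => ?_, ?_⟩
  · rw [map_sub, map_smul, smul_eq_mul]
    rcases eq_or_ne c 0 with hc | hc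
    · have hkernel : kernel θ 0 = 0 := by
        rw [← inner_self_eq_zero (𝕜 := ℂ), inner_kernel_zero]
        exact hc
      rw [← inner_kernel_zero (d n), hkernel, inner_zero_left, zero_mul, zero_mul, sub_zero]
    · rw [inv_mul_cancel_right₀ hc, sub_self]
  · have heval : Tendsto (fun n => evalZero θ (d n)) atTop (𝓝 0) :=
      hf ▸ ((evalZero θ).continuous.tendsto f).comp hlim
    simpa using hlim.sub ((heval.mul_const c⁻¹).smul_const (kernel θ 0))

theorem IsTruncatedToeplitz.shiftInvariant {A : modelSpace θ →L[ℂ] modelSpace θ}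
    (hA : IsTruncatedToeplitz θ A) : ShiftInvariant A := by
  obtain ⟨φ, hφ⟩ := hA
  intro f g hf hg
  obtain ⟨d, hd, hd₀, hlim⟩ := exists_seq_boundedFunctions hf
  have hbounded : ∀ n, inner ℂ g (A (d n)) =
      inner ℂ (backwardShift θ g) (A (backwardShift θ (d n))) := by
    intro n
    rw [hφ _ (mem_boundedFunctions.mp (hd n)), hφ _ (mem_boundedFunctions.mp
      (backwardShift_mem_boundedFunctions (hd n) (hd₀ n))),
      inner_orthogonalProjectionOnto_mulBdd, inner_orthogonalProjectionOnto_mulBdd]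
    refine integral_congr_ae ?_
    filter_upwards [coeFn_backwardShift_of_evalZero hg,
      coeFn_backwardShift_of_evalZero (hd₀ n)] with t hgt hdt
    rw [hgt, hdt, map_mul, ← conj_fourier_one, Complex.conj_conj]
    linear_combination -conj ((g : L2) t) * (φ t * (d n : L2) t) * conj_fourier_mul_self t
  have hleft : Tendsto (fun n => inner ℂ g (A (d n))) atTop (𝓝 (inner ℂ g (A f))) :=
    tendsto_const_nhds.inner ((A.continuous.tendsto f).comp hlim)
  have hright : Tendsto (fun n => inner ℂ (backwardShift θ g) (A (backwardShift θ (d n)))) atTop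
      (𝓝 (inner ℂ (backwardShift θ g) (A (backwardShift θ f)))) :=
    tendsto_const_nhds.inner
      (((A.continuous.comp (backwardShift θ).continuous).tendsto f).comp hlim)
  simp only [hbounded] at hleft
  exact tendsto_nhds_unique hleft hright

lemma mulFourier_one_mem_hardy {h : L2} (hh : h ∈ hardy) : mulFourier 1 h ∈ hardy := by
  intro n hn
  rw [fourierCoeff_mulFourier_one]
  exact hh _ (by lia)

lemma inner_backwardShift_hardy (g : modelSpace θ) {h : L2} (hh : h ∈ hardy) :
    inner ℂ (backwardShift θ g : L2) h = inner ℂ (g : L2) (mulFourier 1 h) := by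
  have hmean : ∫ t, mulFourier 1 h t ∂leb = 0 := by
    rw [integral_eq_fourierCoeff_zero, fourierCoeff_mulFourier_one]
    exact hh _ (by norm_num)
  have hpointwise : (fun t => conj ((backwardShift θ g : L2) t) * h t) =ᵐ[leb] fun t =>
      conj ((g : L2) t) * mulFourier 1 h t
        - conj (fourierCoeff (g : L2) 0) * mulFourier 1 h t := by
    filter_upwards [coeFn_backwardShiftL2 (g : L2), coeFn_mulFourier 1 h] with t hshift hmul
    rw [coe_backwardShift, hshift, hmul, map_mul, map_sub, ← conj_fourier_one, Complex.conj_conj]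
    ring
  rw [inner_eq_integral, integral_congr_ae hpointwise, integral_sub (integrable_conj_mul _ _)
    ((L2.integrable _).const_mul _), integral_const_mul, hmean, mul_zero, sub_zero,
    inner_eq_integral]

lemma inner_backwardShift_pow_hardy (g : modelSpace θ) {h : L2} (hh : h ∈ hardy) (n : ℕ) :
    inner ℂ ((backwardShift θ ^ n) g : L2) h =
      ∫ t, conj ((g : L2) t) * (fourier n t * h t) ∂leb := by
  induction n generalizing h with
  | zero => simp [inner_eq_integral]
  | succ n ih =>
    rw [pow_succ', mul_apply_eq_comp, inner_backwardShift_hardy _ hh,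
      ih (mulFourier_one_mem_hardy hh)]
    refine integral_congr_ae ?_
    filter_upwards [coeFn_mulFourier 1 h] with t hmul
    rw [hmul, Nat.cast_succ, fourier_add]
    ring

lemma hasSum_fourier_series_hardy {f : L2} (hf : f ∈ hardy) :
    HasSum (fun n : ℕ => fourierCoeff f (n : ℤ) • (fourierLp 2 (n : ℤ) : L2)) f := by
  refine (Nat.cast_injective.hasSum_iff (f := fun n : ℤ =>
    fourierCoeff f n • (fourierLp 2 n : L2)) fun n hn => ?_).mpr (hasSum_fourier_series_L2 f)
  rw [hf n (not_le.1 fun h => hn (Int.eq_ofNat_of_zero_le h |>.imp fun _ => Eq.symm)), zero_smul]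

lemma hasSum_fourierCoeff_mul_inner {g : modelSpace θ} (hg : MemLp (g : L2) ∞ leb) {h f : L2}
    (hh : h ∈ hardy) (hf : f ∈ hardy) :
    HasSum (fun n : ℕ => fourierCoeff f (n : ℤ) * inner ℂ ((backwardShift θ ^ n) g : L2) h)
      (∫ t, conj ((g : L2) t) * h t * f t ∂leb) := by
  have hu : MemLp (fun t => conj (conj ((g : L2) t) * h t)) 2 leb :=
    (((Lp.memLp h).mul' (hg.star : MemLp (star ((g : L2) : Torus → ℂ)) ∞ leb) :
      MemLp (fun t => star ((g : L2) : Torus → ℂ) t * h t) 2 leb)).star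
  have inner_u : ∀ x : L2,
      innerSL ℂ (hu.toLp _ : L2) x = ∫ t, conj ((g : L2) t) * h t * x t ∂leb := by
    intro x
    rw [innerSL_apply_apply, inner_eq_integral]
    refine integral_congr_ae ?_
    filter_upwards [hu.coeFn_toLp] with t ht
    rw [ht, Complex.conj_conj]
  have inner_shift : ∀ n : ℕ, inner ℂ ((backwardShift θ ^ n) g : L2) h =
      innerSL ℂ (hu.toLp _ : L2) (fourierLp 2 (n : ℤ) : L2) := by
    intro n
    rw [inner_backwardShift_pow_hardy g hh, inner_u]
    refine integral_congr_ae ?_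
    filter_upwards [coeFn_fourierLp (T := 1) 2 (n : ℤ)] with t ht
    rw [ht]
    ring
  have hsum := (innerSL ℂ (hu.toLp _ : L2)).hasSum (hasSum_fourier_series_hardy hf)
  simpa only [inner_u f, map_smul, smul_eq_mul, ← inner_shift] using hsum

lemma inner_eq_sum_add {A : modelSpace θ →L[ℂ] modelSpace θ} {ψ χ : modelSpace θ}
    (hA : ∀ f g, inner ℂ g (A f) = inner ℂ (backwardShift θ g) (A (backwardShift θ f))
      + (evalZero θ f * inner ℂ g ψ + conj (evalZero θ g * inner ℂ f χ))) (f g : modelSpace θ)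
    (N : ℕ) :
    inner ℂ g (A f) = inner ℂ ((backwardShift θ ^ N) g) (A ((backwardShift θ ^ N) f))
      + ((∑ n ∈ Finset.range N,
          fourierCoeff (f : L2) (n : ℤ) * inner ℂ ((backwardShift θ ^ n) g) ψ)
        + conj (∑ n ∈ Finset.range N,
          fourierCoeff (g : L2) (n : ℤ) * inner ℂ ((backwardShift θ ^ n) f) χ)) := by
  induction N with
  | zero => simp
  | succ N ih =>
    rw [ih, hA ((backwardShift θ ^ N) f), Finset.sum_range_succ, Finset.sum_range_succ,
      evalZero_backwardShift_pow, evalZero_backwardShift_pow, pow_succ', mul_apply_eq_comp,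
      mul_apply_eq_comp, map_add]
    ring

lemma inner_eq_integral_add_of_defect {A : modelSpace θ →L[ℂ] modelSpace θ} {ψ χ : modelSpace θ}
    (hA : ∀ f g, inner ℂ g (A f) = inner ℂ (backwardShift θ g) (A (backwardShift θ f))
      + (evalZero θ f * inner ℂ g ψ + conj (evalZero θ g * inner ℂ f χ)))
    {f g : modelSpace θ} (hf : MemLp (f : L2) ∞ leb) (hg : MemLp (g : L2) ∞ leb) :
    inner ℂ g (A f) = ∫ t, conj ((g : L2) t) * (ψ : L2) t * (f : L2) t ∂leb
      + conj (∫ t, conj ((f : L2) t) * (χ : L2) t * (g : L2) t ∂leb) := by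
  have hremainder : Tendsto
      (fun N => inner ℂ ((backwardShift θ ^ N) g) (A ((backwardShift θ ^ N) f)))
      atTop (𝓝 0) := by
    simpa using (tendsto_backwardShift_pow g).inner (𝕜 := ℂ)
      ((A.continuous.tendsto 0).comp (tendsto_backwardShift_pow f))
  have hψ := (hasSum_fourierCoeff_mul_inner hg ψ.2.1 f.2.1).tendsto_sum_nat
  have hχ := (hasSum_fourierCoeff_mul_inner hf χ.2.1 g.2.1).tendsto_sum_nat
  rw [← zero_add (_ + _)]
  exact tendsto_nhds_unique (tendsto_const_nhds.congr (inner_eq_sum_add hA f g))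
    (hremainder.add (hψ.add ((Complex.continuous_conj.tendsto _).comp hχ)))

lemma memLp_add_conj (ψ χ : L2) : MemLp (fun t => ψ t + conj (χ t)) 2 leb :=
  (Lp.memLp ψ).add (Lp.memLp χ).star

lemma isTruncatedToeplitz_of_defect {A : modelSpace θ →L[ℂ] modelSpace θ} {ψ χ : modelSpace θ}
    (hA : ∀ f g, inner ℂ g (A f) = inner ℂ (backwardShift θ g) (A (backwardShift θ f))
      + (evalZero θ f * inner ℂ g ψ + conj (evalZero θ g * inner ℂ f χ))) :
    IsTruncatedToeplitz θ A := by
  refine ⟨(memLp_add_conj (ψ : L2) χ).toLp _, fun f hf => ?_⟩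
  rw [← sub_eq_zero]
  refine dense_boundedFunctions.eq_zero_of_inner_right ℂ fun g hg => ?_
  have hψ : Integrable (fun t => conj ((g : L2) t) * (ψ : L2) t * (f : L2) t) leb :=
    MemLp.integrable_mul (p := 2) (q := 2) ((Lp.memLp (ψ : L2)).mul'
      (hg.star : MemLp (star ((g : L2) : Torus → ℂ)) ∞ leb)) (Lp.memLp (f : L2))
  have hχ : Integrable (fun t => (f : L2) t * conj ((χ : L2) t) * conj ((g : L2) t)) leb :=
    MemLp.integrable_mul (p := 2) (q := 2) ((Lp.memLp (χ : L2)).star.mul' hf)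
      (Lp.memLp (g : L2)).star
  rw [inner_sub_right, sub_eq_zero, inner_orthogonalProjectionOnto_mulBdd,
    inner_eq_integral_add_of_defect hA hf hg, ← integral_conj]
  simp only [map_mul, Complex.conj_conj]
  rw [← integral_add hψ hχ]
  refine integral_congr_ae ?_
  filter_upwards [(memLp_add_conj (ψ : L2) χ).coeFn_toLp] with t ht
  rw [ht]
  ring

lemma inner_apply_eq_of_orthogonal {𝕜 H : Type*} [RCLike 𝕜] [NormedAddCommGroup H]
    [InnerProductSpace 𝕜 H] [CompleteSpace H] {E : H →L[𝕜] H} {b k : H} (hb : inner 𝕜 k b = 1)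
    (hE : ∀ f g, inner 𝕜 k f = 0 → inner 𝕜 k g = 0 → inner 𝕜 g (E f) = 0) (f g : H) :
    inner 𝕜 g (E f) = inner 𝕜 k f * inner 𝕜 g (E b) + conj (inner 𝕜 k g *
      inner 𝕜 f (ContinuousLinearMap.adjoint E b - conj (inner 𝕜 b (E b)) • k)) := by
  have hvanish : inner 𝕜 (g - inner 𝕜 k g • b) (E (f - inner 𝕜 k f • b)) = 0 :=
    hE _ _ (by simp [inner_sub_right, inner_smul_right, hb])
      (by simp [inner_sub_right, inner_smul_right, hb])
  rw [map_mul, inner_conj_symm _ f, inner_sub_left, ContinuousLinearMap.adjoint_inner_left,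
    inner_smul_left, RCLike.conj_conj]
  simp only [map_sub, map_smul, inner_sub_left, inner_sub_right, inner_smul_left,
    inner_smul_right] at hvanish
  linear_combination hvanish

theorem ShiftInvariant.isTruncatedToeplitz {A : modelSpace θ →L[ℂ] modelSpace θ}
    (hA : ShiftInvariant A) {b : modelSpace θ} (hb : evalZero θ b = 1) :
    IsTruncatedToeplitz θ A := by
  set E : modelSpace θ →L[ℂ] modelSpace θ :=
    A - (ContinuousLinearMap.adjoint (backwardShift θ)).comp (A.comp (backwardShift θ)) with hE
  have inner_E : ∀ f g, inner ℂ g (E f) =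
      inner ℂ g (A f) - inner ℂ (backwardShift θ g) (A (backwardShift θ f)) := by
    intro f g
    rw [hE, sub_apply, inner_sub_right, ContinuousLinearMap.comp_apply,
      ContinuousLinearMap.adjoint_inner_right, ContinuousLinearMap.comp_apply]
  have hdefect := inner_apply_eq_of_orthogonal (E := E) ((inner_kernel_zero b).trans hb)
    fun f g hf hg => by
      rw [inner_E, sub_eq_zero]
      exact hA f g (inner_kernel_zero f ▸ hf) (inner_kernel_zero g ▸ hg)
  simp only [inner_kernel_zero] at hdefect
  exact isTruncatedToeplitz_of_defect fun f g =>
    sub_eq_iff_eq_add'.mp ((inner_E f g).symm.trans (hdefect f g))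

/-! ### Iterated derivatives -/

section IteratedDeriv

variable {𝕜 E F : Type*} [NontriviallyNormedField 𝕜] [NormedAddCommGroup E] [NormedSpace 𝕜 E]
  [NormedAddCommGroup F] [NormedSpace 𝕜 F]

lemma iteratedDeriv_continuousLinearMap_apply (L : E →L[𝕜] F) {f : 𝕜 → E} {n : ℕ} {w : 𝕜}
    (hf : ContDiffAt 𝕜 n f w) :
    iteratedDeriv n (fun u => L (f u)) w = L (iteratedDeriv n f w) := by
  simp only [iteratedDeriv_eq_iteratedFDeriv]
  exact congrArg (· fun _ => 1) (L.iteratedFDeriv_comp_left hf le_rfl)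

lemma iteratedDeriv_succ_id_mul {f : 𝕜 → 𝕜} {j : ℕ} {w : 𝕜} (hf : ContDiffAt 𝕜 (j + 1 : ℕ) f w) :
    iteratedDeriv (j + 1) (fun u => u * f u) w =
      w * iteratedDeriv (j + 1) f w + (j + 1) * iteratedDeriv j f w := by
  have hLeibniz := iteratedDeriv_mul contDiffAt_id hf
  rw [Finset.sum_range_succ', Finset.sum_range_succ', Finset.sum_eq_zero] at hLeibniz
  · exact hLeibniz.trans (by simp [iteratedDeriv_one]; ring)
  · simp [iteratedDeriv_id]

end IteratedDeriv

lemma iteratedDeriv_semilinearMap_comp_conj {E F : Type*} [NormedAddCommGroup E]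
    [NormedSpace ℂ E] [CompleteSpace E] [NormedAddCommGroup F] [NormedSpace ℂ F]
    (C : E →L⋆[ℂ] F) {f : ℂ → E} {w : ℂ} (hf : AnalyticAt ℂ f (conj w)) (n : ℕ) :
    iteratedDeriv n (fun u => C (f (conj u))) w = C (iteratedDeriv n f (conj w)) := by
  induction n generalizing f with
  | zero => rfl
  | succ n ih =>
    have hderiv : deriv (fun u => C (f (conj u))) =ᶠ[𝓝 w] fun u => C (deriv f (conj u)) := by
      filter_upwards [Complex.continuous_conj.tendsto w |>.eventually hf.eventually_analyticAt]
        with u hu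
      exact (Complex.conj_conj u ▸
        hu.differentiableAt.hasDerivAt.comp_semilinear (starRingEnd ℂ) C).deriv
    rw [iteratedDeriv_succ', iteratedDeriv_succ', hderiv.iteratedDeriv_eq, ih hf.deriv]

section Leibniz

variable {𝕜 H : Type*} [RCLike 𝕜] [NormedAddCommGroup H] [InnerProductSpace 𝕜 H]

/-- The sum `∑ i ≤ n, (n choose i) a (n - i) ⊗ b i`, which by the Leibniz rule is the `n`-th
derivative of `x ⊗ C x`, `C` antilinear, when `a j` and `b j` are the `j`-th derivatives of `x`
and of `C x`. -/
def leibnizOperator (n : ℕ) (a b : ℕ → H) : H →L[𝕜] H :=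
  ∑ i ∈ Finset.range (n + 1), (n.choose i : 𝕜) • InnerProductSpace.rankOne 𝕜 (a (n - i)) (b i)

lemma leibnizOperator_apply (n : ℕ) (a b : ℕ → H) (h : H) :
    leibnizOperator (𝕜 := 𝕜) n a b h =
      ∑ i ∈ Finset.range (n + 1), ((n.choose i : 𝕜) * inner 𝕜 (b i) h) • a (n - i) := by
  simp only [leibnizOperator, sum_apply, smul_apply, InnerProductSpace.rankOne_apply, smul_smul]

lemma inner_leibnizOperator_apply (n : ℕ) (a b : ℕ → H) (g h : H) :
    inner 𝕜 g (leibnizOperator (𝕜 := 𝕜) n a b h) =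
      ∑ i ∈ Finset.range (n + 1),
        (n.choose i : 𝕜) * inner 𝕜 (b i) h * inner 𝕜 g (a (n - i)) := by
  simp only [leibnizOperator_apply, inner_sum, inner_smul_right]

lemma contDiffAt_rankOne_semilinearMap (C : H →L⋆[𝕜] H) {x : 𝕜 → H} {n : ℕ} {w : 𝕜}
    (hx : ContDiffAt 𝕜 n x w) :
    ContDiffAt 𝕜 n (fun u => InnerProductSpace.rankOne 𝕜 (x u) (C (x u))) w := by
  let J : H →L[𝕜] StrongDual 𝕜 H := (innerSL 𝕜 (E := H)).comp C
  have hJ : ContDiffAt 𝕜 n (fun u => ContinuousLinearMap.smulRightL 𝕜 H H (J (x u))) w :=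
    ((ContinuousLinearMap.smulRightL 𝕜 H H).comp J).contDiff.contDiffAt.comp w hx
  exact hJ.clm_apply hx

lemma iteratedDeriv_inner_mul_inner (C : H →L⋆[𝕜] H) {x : 𝕜 → H} {n : ℕ} {w : 𝕜}
    (hx : ContDiffAt 𝕜 n x w) (g h : H) :
    iteratedDeriv n (fun u => inner 𝕜 (C (x u)) h * inner 𝕜 g (x u)) w =
      ∑ i ∈ Finset.range (n + 1), (n.choose i : 𝕜) * inner 𝕜 (C (iteratedDeriv i x w)) h *
        inner 𝕜 g (iteratedDeriv (n - i) x w) := by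
  let left : H →L[𝕜] 𝕜 := ((innerSL 𝕜).flip h).comp C
  refine (iteratedDeriv_fun_mul (left.contDiff.contDiffAt.comp w hx)
    ((innerSL 𝕜 g).contDiff.contDiffAt.comp w hx)).trans (Finset.sum_congr rfl fun i hi => ?_)
  have hi : i ≤ n := Finset.mem_range_succ_iff.mp hi
  have hleft := iteratedDeriv_continuousLinearMap_apply left (hx.of_le (mod_cast hi))
  have hright := iteratedDeriv_continuousLinearMap_apply (innerSL 𝕜 g)
    (hx.of_le (mod_cast n.sub_le i))
  exact congrArg₂ (fun y z => (n.choose i : 𝕜) * y * z) hleft hright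

lemma iteratedDeriv_rankOne_semilinearMap (C : H →L⋆[𝕜] H) {x : 𝕜 → H} {n : ℕ} {w : 𝕜}
    (hx : ContDiffAt 𝕜 n x w) :
    iteratedDeriv n (fun u => InnerProductSpace.rankOne 𝕜 (x u) (C (x u))) w =
      leibnizOperator n (fun j => iteratedDeriv j x w) fun j => C (iteratedDeriv j x w) := by
  ext h
  refine ext_inner_left 𝕜 fun g => ?_
  rw [inner_leibnizOperator_apply, ← iteratedDeriv_inner_mul_inner C hx]
  let entry : (H →L[𝕜] H) →L[𝕜] 𝕜 := (innerSL 𝕜 g).comp (ContinuousLinearMap.apply 𝕜 H h)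
  refine (iteratedDeriv_continuousLinearMap_apply entry
    (contDiffAt_rankOne_semilinearMap C hx)).symm.trans ?_
  congr 1 with u
  exact inner_smul_right _ _ _

lemma exists_apply_eq_one_of_linearIndependent {K V ι : Type*} [Field K] [AddCommGroup V]
    [Module K V] [Finite ι] {φ : ι → Module.Dual K V} (hφ : LinearIndependent K φ) (j : ι) :
    ∃ v, φ j v = 1 ∧ ∀ i ≠ j, φ i v = 0 := by
  have hnotMem : φ j ∉ Submodule.span K (Set.range fun i : {i // i ≠ j} => φ i) := by
    have := hφ.notMem_span_image (s := {i | i ≠ j}) (x := j) (by simp)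
    rwa [Set.image_eq_range] at this
  obtain ⟨v, hv, hvj⟩ := SetLike.not_le_iff_exists.mp (mt mem_span_of_iInf_ker_le_ker hnotMem)
  refine ⟨(φ j v)⁻¹ • v, by simpa using inv_mul_cancel₀ hvj, fun i hi => ?_⟩
  simp [LinearMap.mem_ker.mp ((Submodule.mem_iInf _).mp hv ⟨i, hi⟩)]

lemma range_leibnizOperator {n : ℕ} {a b : ℕ → H}
    (hb : LinearIndependent 𝕜 fun j : Fin (n + 1) => innerₛₗ 𝕜 (b j)) :
    (leibnizOperator n a b : H →L[𝕜] H).range =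
      Submodule.span 𝕜 (Set.range fun j : Fin (n + 1) => a j) := by
  refine le_antisymm ?_ (Submodule.span_le.mpr ?_)
  · rintro _ ⟨h, rfl⟩
    rw [ContinuousLinearMap.coe_coe, leibnizOperator_apply]
    exact Submodule.sum_mem _ fun i _ => Submodule.smul_mem _ _
      (Submodule.subset_span ⟨⟨n - i, by lia⟩, rfl⟩)
  · rintro _ ⟨⟨j, hj⟩, rfl⟩
    obtain ⟨h, hone, hzero⟩ := exists_apply_eq_one_of_linearIndependent hb ⟨n - j, by lia⟩
    have hchoose : (n.choose (n - j) : 𝕜) ≠ 0 :=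
      Nat.cast_ne_zero.mpr (Nat.choose_pos (n.sub_le j)).ne'
    refine (Submodule.smul_mem_iff _ hchoose).mp ⟨h, ?_⟩
    rw [ContinuousLinearMap.coe_coe, leibnizOperator_apply, Finset.sum_eq_single (n - j)]
    · rw [innerₛₗ_apply_apply] at hone
      rw [hone, mul_one, Nat.sub_sub_self (by lia)]
    · intro i hi hij
      have hzero := hzero ⟨i, Finset.mem_range.mp hi⟩ (by simpa using hij)
      rw [innerₛₗ_apply_apply] at hzero
      rw [hzero, mul_zero, zero_smul]
    · simp

end Leibniz

/-! ### Jets of reproducing kernels -/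

/-- The `j`-th derivative of the reproducing kernel `kernel θ w` with respect to `conj w`: the
vector representing `f ↦ f⁽ʲ⁾(w)`. -/
def kernelDeriv (θ : InnerFunction) (j : ℕ) (w : ℂ) : modelSpace θ :=
  iteratedDeriv j (fun ν => kernel θ (conj ν)) (conj w)

lemma analyticAt_kernel_conj {ν : ℂ} (hν : ‖ν‖ < 1) :
    AnalyticAt ℂ (fun ν => kernel θ (conj ν)) ν :=
  DifferentiableOn.analyticAt (s := {ν | ‖ν‖ < 1})
    (fun _ hμ => (differentiableAt_kernel_conj hμ).differentiableWithinAt) (disk_mem_nhds hν)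

lemma analyticAt_kernel_conj_conj {w : ℂ} (hw : ‖w‖ < 1) :
    AnalyticAt ℂ (fun ν => kernel θ (conj ν)) (conj w) :=
  analyticAt_kernel_conj (by rwa [RCLike.norm_conj])

lemma inner_kernelDeriv (j : ℕ) {w : ℂ} (hw : ‖w‖ < 1) (f : modelSpace θ) :
    inner ℂ (kernelDeriv θ j w) f = iteratedDeriv j (diskValue (f : L2)) w := by
  have hdisk : (fun u => inner ℂ (kernel θ (conj (conj u))) f) =ᶠ[𝓝 w] diskValue (f : L2) := by
    filter_upwards [disk_mem_nhds hw] with u hu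
    rw [Complex.conj_conj, inner_kernel_eq_diskValue hu]
  rw [← hdisk.iteratedDeriv_eq]
  exact (iteratedDeriv_semilinearMap_comp_conj ((innerSL ℂ).flip f)
    (analyticAt_kernel_conj_conj hw) j).symm

lemma inner_kernelDeriv_zero {w : ℂ} (hw : ‖w‖ < 1) (f : modelSpace θ) :
    inner ℂ (kernelDeriv θ 0 w) f =
      w * inner ℂ (kernelDeriv θ 0 w) (backwardShift θ f) + evalZero θ f := by
  simpa only [inner_kernelDeriv 0 hw, iteratedDeriv_zero] using diskValue_backwardShift f hw

lemma inner_kernelDeriv_succ (j : ℕ) {w : ℂ} (hw : ‖w‖ < 1) (f : modelSpace θ) :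
    inner ℂ (kernelDeriv θ (j + 1) w) f =
      w * inner ℂ (kernelDeriv θ (j + 1) w) (backwardShift θ f)
        + (j + 1) * inner ℂ (kernelDeriv θ j w) (backwardShift θ f) := by
  have hshift : diskValue (f : L2) =ᶠ[𝓝 w]
      fun u => evalZero θ f + u * diskValue (backwardShift θ f : L2) u := by
    filter_upwards [disk_mem_nhds hw] with u hu
    rw [diskValue_backwardShift f hu, add_comm]
  simp only [inner_kernelDeriv _ hw]
  rw [hshift.iteratedDeriv_eq, iteratedDeriv_const_add j.succ_pos,
    iteratedDeriv_succ_id_mul (analyticAt_diskValue _ hw).contDiffAt]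

/-- The vectors `κ 0, …, κ n` are the weak limits along `l`, a filter on the disk converging to `w`,
of the vectors representing the derivatives of order `0, …, n` of the functions of the model
space. -/
structure RepresentsJet (θ : InnerFunction) (n : ℕ) (w : ℂ) (l : Filter ℂ)
    (κ : ℕ → modelSpace θ) : Prop where
  le_nhds : l ≤ 𝓝 w
  eventually_disk : ∀ᶠ u in l, ‖u‖ < 1
  tendsto : ∀ j ≤ n, ∀ f : modelSpace θ,
    Tendsto (fun u => inner ℂ (kernelDeriv θ j u) f) l (𝓝 (inner ℂ (κ j) f))

namespace RepresentsJet

variable {n : ℕ} {w : ℂ} {l : Filter ℂ} {κ : ℕ → modelSpace θ}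

lemma inner_zero [l.NeBot] (h : RepresentsJet θ n w l κ) (f : modelSpace θ) :
    inner ℂ (κ 0) f = w * inner ℂ (κ 0) (backwardShift θ f) + evalZero θ f := by
  have hid : Tendsto (fun u : ℂ => u) l (𝓝 w) := h.le_nhds
  refine tendsto_nhds_unique ((h.tendsto 0 n.zero_le f).congr' ?_)
    ((hid.mul (h.tendsto 0 n.zero_le (backwardShift θ f))).add_const (evalZero θ f))
  filter_upwards [h.eventually_disk] with u hu using inner_kernelDeriv_zero hu f

lemma inner_succ [l.NeBot] (h : RepresentsJet θ n w l κ) {j : ℕ} (hj : j < n)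
    (f : modelSpace θ) :
    inner ℂ (κ (j + 1)) f = w * inner ℂ (κ (j + 1)) (backwardShift θ f)
      + (j + 1) * inner ℂ (κ j) (backwardShift θ f) := by
  have hid : Tendsto (fun u : ℂ => u) l (𝓝 w) := h.le_nhds
  refine tendsto_nhds_unique ((h.tendsto (j + 1) hj f).congr' ?_)
    ((hid.mul (h.tendsto (j + 1) hj (backwardShift θ f))).add
      ((h.tendsto j hj.le (backwardShift θ f)).const_mul ((j : ℂ) + 1)))
  filter_upwards [h.eventually_disk] with u hu using inner_kernelDeriv_succ j hu f

lemma mono (h : RepresentsJet θ n w l κ) {m : ℕ} (hm : m ≤ n) : RepresentsJet θ m w l κ :=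
  ⟨h.le_nhds, h.eventually_disk, fun j hj => h.tendsto j (hj.trans hm)⟩

end RepresentsJet

lemma representsJet_pure (n : ℕ) {w : ℂ} (hw : ‖w‖ < 1) :
    RepresentsJet θ n w (pure w) fun j => kernelDeriv θ j w where
  le_nhds := pure_le_nhds w
  eventually_disk := hw
  tendsto _ _ _ := tendsto_pure_nhds _ _

lemma exists_inner_of_tendsto {𝕜 H α : Type*} [RCLike 𝕜] [NormedAddCommGroup H]
    [InnerProductSpace 𝕜 H] [CompleteSpace H] {l : Filter α} [l.IsCountablyGenerated] [l.NeBot]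
    {y : α → H} (hy : ∀ f, ∃ L : 𝕜, Tendsto (fun u => inner 𝕜 (y u) f) l (𝓝 L)) :
    ∃ x : H, ∀ f, Tendsto (fun u => inner 𝕜 (y u) f) l (𝓝 (inner 𝕜 x f)) := by
  choose L hL using hy
  have hpi : Tendsto (fun u f => innerSL 𝕜 (y u) f) l (𝓝 L) := tendsto_pi_nhds.mpr hL
  refine ⟨(InnerProductSpace.toDual 𝕜 H).symm
    (continuousLinearMapOfTendsto (fun u => innerSL 𝕜 (y u)) hpi), fun f => ?_⟩
  rw [InnerProductSpace.toDual_symm_apply]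
  exact hL f

lemma nhdsWithin_stolzAngle_neBot {M : ℝ} (hM : 1 < M) {ζ : ℂ} (hζ : ‖ζ‖ = 1) :
    (𝓝[stolzAngle M ζ] ζ).NeBot := by
  refine Tendsto.neBot (f := fun r : ℝ => (r : ℂ) * ζ) (x := 𝓝[<] 1)
    (tendsto_nhdsWithin_iff.mpr ⟨?_, ?_⟩)
  · exact ((by fun_prop : Continuous fun r : ℝ => (r : ℂ) * ζ).tendsto' 1 ζ
      (by simp)).mono_left nhdsWithin_le_nhds
  · filter_upwards [Ioo_mem_nhdsLT zero_lt_one] with r hr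
    have hnorm : ‖(r : ℂ) * ζ‖ = r := by simp [hζ, hr.1.le]
    have hdist : ‖ζ - r * ζ‖ = 1 - r := by
      rw [← one_sub_mul, norm_mul, hζ, mul_one, ← Complex.ofReal_one, ← Complex.ofReal_sub,
        Complex.norm_of_nonneg (sub_nonneg.mpr hr.2.le)]
    refine ⟨hnorm.trans_lt hr.2, ?_⟩
    rw [hnorm, hdist]
    exact lt_mul_of_one_lt_left (sub_pos.mpr hr.2) hM

lemma nhdsWithin_stolzAngle_le_nontangential (M : ℝ) (ζ : ℂ) :
    𝓝[stolzAngle M ζ] ζ ≤ nontangential ζ :=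
  le_iSup (fun M => 𝓝[stolzAngle M ζ] ζ) M

lemma nontangential_neBot {ζ : ℂ} (hζ : ‖ζ‖ = 1) : (nontangential ζ).NeBot :=
  have := nhdsWithin_stolzAngle_neBot one_lt_two hζ
  .mono this (nhdsWithin_stolzAngle_le_nontangential 2 ζ)

lemma nontangential_le_nhds (ζ : ℂ) : nontangential ζ ≤ 𝓝 ζ :=
  iSup_le fun _ => nhdsWithin_le_nhds

lemma eventually_nontangential (ζ : ℂ) : ∀ᶠ u in nontangential ζ, ‖u‖ < 1 := by
  rw [nontangential, eventually_iSup]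
  exact fun M => eventually_mem_nhdsWithin.mono fun _ hu => hu.1

lemma exists_tendsto_inner_kernelDeriv {n j : ℕ} (hj : j ≤ n) {ζ : ℂ} (hζ : ζ ∈ Omega θ n) :
    ∃ κ : modelSpace θ, ∀ f : modelSpace θ,
      Tendsto (fun u => inner ℂ (kernelDeriv θ j u) f) (nontangential ζ) (𝓝 (inner ℂ κ f)) := by
  have hlim : ∀ f : modelSpace θ, ∃ L,
      Tendsto (fun u => inner ℂ (kernelDeriv θ j u) f) (nontangential ζ) (𝓝 L) := fun f => by
    obtain ⟨L, hL⟩ := hζ.2 f f.2 j hj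
    refine ⟨L, hL.congr' ?_⟩
    filter_upwards [eventually_nontangential ζ] with u hu using (inner_kernelDeriv j hu f).symm
  choose L hL using hlim
  have := nhdsWithin_stolzAngle_neBot one_lt_two hζ.1
  have hstolz := fun f => (hL f).mono_left (nhdsWithin_stolzAngle_le_nontangential 2 ζ)
  obtain ⟨κ, hκ⟩ := exists_inner_of_tendsto fun f => ⟨L f, hstolz f⟩
  exact ⟨κ, fun f => tendsto_nhds_unique (hκ f) (hstolz f) ▸ hL f⟩

lemma exists_representsJet_nontangential {n : ℕ} {ζ : ℂ} (hζ : ζ ∈ Omega θ n) :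
    ∃ κ, RepresentsJet θ n ζ (nontangential ζ) κ := by
  choose! κ hκ using fun j (hj : j ≤ n) => exists_tendsto_inner_kernelDeriv hj hζ
  exact ⟨κ, nontangential_le_nhds ζ, eventually_nontangential ζ, hκ⟩

/-! ### The operators `opD` and `opDbar` in terms of jets -/

lemma iteratedDeriv_rankOne_kernel_conj (n : ℕ) {w : ℂ} (hw : ‖w‖ < 1) :
    iteratedDeriv n (fun ν => InnerProductSpace.rankOne ℂ (kernel θ (conj ν))
        (conjKernel θ (conj ν))) (conj w) =
      leibnizOperator n (fun j => kernelDeriv θ j w)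
        fun j => conjugation θ (kernelDeriv θ j w) := by
  simp only [← conjugation_kernel]
  exact iteratedDeriv_rankOne_semilinearMap _ (analyticAt_kernel_conj_conj hw).contDiffAt

lemma iteratedDeriv_conjKernel (j : ℕ) {w : ℂ} (hw : ‖w‖ < 1) :
    iteratedDeriv j (conjKernel θ) w = conjugation θ (kernelDeriv θ j w) := by
  have hconj : conjKernel θ = fun u => conjugation θ (kernel θ (conj (conj u))) := by
    simp only [conjugation_kernel, Complex.conj_conj]
  rw [hconj]
  exact iteratedDeriv_semilinearMap_comp_conj _ (analyticAt_kernel_conj_conj hw) j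

lemma analyticAt_conjKernel {w : ℂ} (hw : ‖w‖ < 1) : AnalyticAt ℂ (conjKernel θ) w := by
  refine DifferentiableOn.analyticAt (s := {w | ‖w‖ < 1}) (fun u hu => ?_) (disk_mem_nhds hw)
  have hconj := (analyticAt_kernel_conj_conj (θ := θ) hu).differentiableAt.comp_semilinear₁
    (starRingEnd ℂ) (conjugation θ)
  simp only [Function.comp_def, conjugation_kernel, Complex.conj_conj] at hconj
  exact hconj.differentiableWithinAt

lemma opD_eq_leibnizOperator (n : ℕ) {w : ℂ} (hw : ‖w‖ < 1) :
    opD θ n w = leibnizOperator n (fun j => conjugation θ (kernelDeriv θ j w))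
      fun j => kernelDeriv θ j w := by
  have hkernel : kernel θ = fun u => conjugation θ (conjKernel θ u) := by
    simp only [← conjugation_kernel, conjugation_conjugation]
  rw [opD, boundaryExtend, if_pos hw, hkernel, iteratedDeriv_rankOne_semilinearMap _
    (analyticAt_conjKernel hw).contDiffAt]
  simp only [iteratedDeriv_conjKernel _ hw, conjugation_conjugation]

lemma tendsto_inner_leibnizOperator {𝕜 H α : Type*} [RCLike 𝕜] [NormedAddCommGroup H]
    [InnerProductSpace 𝕜 H] {l : Filter α} {n : ℕ} {a b : α → ℕ → H} {a' b' : ℕ → H}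
    (ha : ∀ j ≤ n, ∀ f, Tendsto (fun u => inner 𝕜 (a u j) f) l (𝓝 (inner 𝕜 (a' j) f)))
    (hb : ∀ j ≤ n, ∀ f, Tendsto (fun u => inner 𝕜 (b u j) f) l (𝓝 (inner 𝕜 (b' j) f)))
    (g h : H) :
    Tendsto (fun u => inner 𝕜 g (leibnizOperator (𝕜 := 𝕜) n (a u) (b u) h)) l
      (𝓝 (inner 𝕜 g (leibnizOperator (𝕜 := 𝕜) n a' b' h))) := by
  simp only [inner_leibnizOperator_apply]
  refine tendsto_finsetSum _ fun i hi =>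
    ((hb i (Finset.mem_range_succ_iff.mp hi) h).const_mul _).mul ?_
  simpa only [RCLike.star_def, inner_conj_symm] using (ha (n - i) (n.sub_le i) g).star

lemma RepresentsJet.tendsto_conjugation {n : ℕ} {w : ℂ} {l : Filter ℂ} {κ : ℕ → modelSpace θ}
    (h : RepresentsJet θ n w l κ) {j : ℕ} (hj : j ≤ n) (f : modelSpace θ) :
    Tendsto (fun u => inner ℂ (conjugation θ (kernelDeriv θ j u)) f) l
      (𝓝 (inner ℂ (conjugation θ (κ j)) f)) := by
  simp only [inner_conjugation_left _ f]
  have hconj (x : modelSpace θ) :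
      inner ℂ (conjugation θ f) x = star (inner ℂ x (conjugation θ f)) :=
    (inner_conj_symm (𝕜 := ℂ) (conjugation θ f) x).symm
  simpa only [hconj] using (h.tendsto j hj (conjugation θ f)).star

lemma opDbar_eq_leibnizOperator (n : ℕ) {w : ℂ} (hw : ‖w‖ < 1) :
    opDbar θ n w = leibnizOperator n (fun j => kernelDeriv θ j w)
      fun j => conjugation θ (kernelDeriv θ j w) := by
  rw [opDbar, boundaryExtend, if_pos hw, iteratedDeriv_rankOne_kernel_conj n hw]

lemma RepresentsJet.opDbar_eq_leibnizOperator {n : ℕ} {ζ : ℂ} (hζ : ‖ζ‖ = 1)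
    {κ : ℕ → modelSpace θ} (h : RepresentsJet θ n ζ (nontangential ζ) κ) :
    opDbar θ n ζ = leibnizOperator n κ fun j => conjugation θ (κ j) := by
  have := nontangential_neBot hζ
  rw [opDbar, boundaryExtend, if_neg hζ.not_lt, Tendsto.limUnder_eq
    (x := ContinuousLinearMapWOT.ofCLM (leibnizOperator n κ fun j => conjugation θ (κ j)))]
  refine ContinuousLinearMapWOT.tendsto_iff_forall_inner_apply_tendsto.mpr fun f g => ?_
  refine (tendsto_inner_leibnizOperator h.tendsto (fun _ => h.tendsto_conjugation) g f).congr' ?_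
  filter_upwards [h.eventually_disk] with u hu
  rw [← iteratedDeriv_rankOne_kernel_conj n hu]
  rfl

lemma exists_representsJet_opDbar {n : ℕ} {w : ℂ} (hw : ‖w‖ < 1 ∨ w ∈ Omega θ n) :
    ∃ (l : Filter ℂ) (κ : ℕ → modelSpace θ), l.NeBot ∧ RepresentsJet θ n w l κ ∧
      ∀ m ≤ n, opDbar θ m w = leibnizOperator m κ fun j => conjugation θ (κ j) := by
  rcases hw with hw | hw
  · exact ⟨pure w, _, inferInstance, representsJet_pure n hw,
      fun m _ => opDbar_eq_leibnizOperator m hw⟩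
  · obtain ⟨κ, hκ⟩ := exists_representsJet_nontangential hw
    exact ⟨nontangential w, κ, nontangential_neBot hw.1, hκ,
      fun m hm => (hκ.mono hm).opDbar_eq_leibnizOperator hw.1⟩

/-! ### Chains of kernels -/

lemma exists_evalZero_eq_one (hdim : ¬ FiniteDimensional ℂ (modelSpace θ)) :
    ∃ b : modelSpace θ, evalZero θ b = 1 := by
  obtain ⟨f, hf⟩ : ∃ f, evalZero θ f ≠ 0 := by
    by_contra! h
    have := subsingleton_of_forall_eq (0 : modelSpace θ) fun f =>
      eq_zero_of_evalZero_pow fun _ => h _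
    exact hdim inferInstance
  exact ⟨(evalZero θ f)⁻¹ • f, by rw [map_smul, smul_eq_mul, inv_mul_cancel₀ hf]⟩

namespace RepresentsJet

variable {n : ℕ} {w : ℂ} {l : Filter ℂ} [l.NeBot] {κ : ℕ → modelSpace θ}

lemma zero_ne_zero (h : RepresentsJet θ n w l κ) (hdim : ¬ FiniteDimensional ℂ (modelSpace θ)) :
    κ 0 ≠ 0 := by
  intro hκ
  obtain ⟨b, hb⟩ := exists_evalZero_eq_one hdim
  simpa [hκ, hb] using h.inner_zero b

lemma inner_conjugation_zero (h : RepresentsJet θ n w l κ) {f : modelSpace θ}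
    (hf : evalZero θ f = 0) : inner ℂ (conjugation θ (κ 0)) (backwardShift θ f) =
      conj w * inner ℂ (conjugation θ (κ 0)) f := by
  simp only [inner_conjugation_left (κ 0)]
  have hrel := h.inner_zero (conjugation θ (backwardShift θ f))
  rw [evalZero_conjugation_backwardShift hf, add_zero,
    backwardShift_conjugation_backwardShift hf] at hrel
  simpa only [map_mul, inner_conj_symm (𝕜 := ℂ) (conjugation θ _)] using congrArg conj hrel

lemma inner_conjugation_succ (h : RepresentsJet θ n w l κ) {j : ℕ} (hj : j < n)
    {f : modelSpace θ} (hf : evalZero θ f = 0) :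
    inner ℂ (conjugation θ (κ (j + 1))) (backwardShift θ f) =
      conj w * inner ℂ (conjugation θ (κ (j + 1))) f
        + (j + 1) * inner ℂ (conjugation θ (κ j)) f := by
  simp only [inner_conjugation_left (κ _)]
  have hrel := h.inner_succ hj (conjugation θ (backwardShift θ f))
  rw [backwardShift_conjugation_backwardShift hf] at hrel
  simpa only [map_add, map_mul, map_one, map_natCast,
    inner_conj_symm (𝕜 := ℂ) (conjugation θ _)] using congrArg conj hrel

lemma isJordanChain (h : RepresentsJet θ n w l κ)
    (hdim : ¬ FiniteDimensional ℂ (modelSpace θ)) :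
    IsJordanChain (backwardShift θ : modelSpace θ →ₗ[ℂ] modelSpace θ)
      (evalZero θ : modelSpace θ →ₗ[ℂ] ℂ) (-w, 1) (1, 0) n fun j => innerₛₗ ℂ (κ j) where
  det_ne_zero := by simp [det]
  zero_ne_zero := fun hκ => h.zero_ne_zero hdim (inner_self_eq_zero.1 (LinearMap.congr_fun hκ _))
  zero_apply f hf := by
    have he : evalZero θ f = 0 := hf
    simp [aeval_linearForm_apply, inner_add_right, inner_smul_right, h.inner_zero f, he]
  succ_apply j hj f _ := by
    simp [aeval_linearForm_apply, inner_add_right, inner_smul_right, h.inner_succ hj f]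

lemma isJordanChain_conjugation (h : RepresentsJet θ n w l κ)
    (hdim : ¬ FiniteDimensional ℂ (modelSpace θ)) :
    IsJordanChain (backwardShift θ : modelSpace θ →ₗ[ℂ] modelSpace θ)
      (evalZero θ : modelSpace θ →ₗ[ℂ] ℂ) (1, -conj w) (0, 1) n
        fun j => innerₛₗ ℂ (conjugation θ (κ j)) where
  det_ne_zero := by simp [det]
  zero_ne_zero hκ := by
    have hconj : conjugation θ (κ 0) = 0 := inner_self_eq_zero.1 (LinearMap.congr_fun hκ _)
    refine h.zero_ne_zero hdim ?_
    rw [← conjugation_conjugation (κ 0), hconj, map_zero]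
  zero_apply f hf := by
    simp [aeval_linearForm_apply, inner_add_right, inner_smul_right, h.inner_conjugation_zero hf]
  succ_apply j hj f hf := by
    simp [aeval_linearForm_apply, inner_add_right, inner_smul_right,
      h.inner_conjugation_succ hj hf]

lemma range_leibnizOperator (h : RepresentsJet θ n w l κ)
    (hdim : ¬ FiniteDimensional ℂ (modelSpace θ)) :
    (leibnizOperator n κ fun j => conjugation θ (κ j) :
        modelSpace θ →L[ℂ] modelSpace θ).range =
      Submodule.span ℂ (Set.range fun j : Fin (n + 1) => κ j) := by
  have hli := (isObservable_backwardShift θ).linearIndependent_of_isJordanChain hdim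
    (h.isJordanChain_conjugation hdim)
  exact TruncatedToeplitz.range_leibnizOperator hli

lemma range_leibnizOperator_conjugation (h : RepresentsJet θ n w l κ)
    (hdim : ¬ FiniteDimensional ℂ (modelSpace θ)) :
    (leibnizOperator n (fun j => conjugation θ (κ j)) κ :
        modelSpace θ →L[ℂ] modelSpace θ).range =
      Submodule.span ℂ (Set.range fun j : Fin (n + 1) => conjugation θ (κ j)) := by
  have hli := (isObservable_backwardShift θ).linearIndependent_of_isJordanChain hdim
    (h.isJordanChain hdim)
  exact TruncatedToeplitz.range_leibnizOperator hli

end RepresentsJet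

/-! ### The spaces `rangeSpace` -/

lemma IsJordanChain.smul {𝕜 V : Type*} [Field 𝕜] [AddCommGroup V] [Module 𝕜 V]
    {T : Module.End 𝕜 V} {e : Module.Dual 𝕜 V} {p q : 𝕜 × 𝕜} {n : ℕ} {x : ℕ → Module.Dual 𝕜 V}
    (h : IsJordanChain T e p q n x) {c : 𝕜} (hc : c ≠ 0) :
    IsJordanChain T e (c • p) (c • q) n x := by
  have hform : ∀ (r : 𝕜 × 𝕜) f, Polynomial.aeval T (linearForm (c • r)) f =
      c • Polynomial.aeval T (linearForm r) f := fun r f => by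
    simp only [aeval_linearForm_apply, Prod.smul_fst, Prod.smul_snd, smul_add, smul_assoc]
  refine ⟨?_, h.zero_ne_zero, fun f hf => ?_, fun j hj f hf => ?_⟩
  · have hdet : det (c • p) (c • q) = c * c * det p q := by simp [det]; ring
    rw [hdet]
    exact mul_ne_zero (mul_ne_zero hc hc) h.det_ne_zero
  · rw [hform, map_smul, h.zero_apply f hf, smul_zero]
  · rw [hform, hform, map_smul, map_smul, h.succ_apply j hj f hf, smul_eq_mul, smul_eq_mul,
      mul_left_comm]

/-- The coefficients of the linear form `1 - w X` attached to a point `w` of the Riemann sphere,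
the form `X` being attached to the point at infinity. -/
def sphereForm (w : OnePoint ℂ) : ℂ × ℂ := w.elim (1, 0) fun w => (-w, 1)

lemma det_sphereForm_ne_zero {w u : OnePoint ℂ} (h : w ≠ u) :
    det (sphereForm w) (sphereForm u) ≠ 0 := by
  cases w <;> cases u <;> simp_all [det, sphereForm, neg_add_eq_zero]

lemma rangeSpace_coe_of_norm_le_one {w : ℂ} (hw : ‖w‖ ≤ 1) (n : ℕ) :
    rangeSpace θ w n = (opDbar θ n w).range := if_pos hw

lemma rangeSpace_coe_of_one_lt_norm {w : ℂ} (hw : 1 < ‖w‖) (n : ℕ) :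
    rangeSpace θ w n = (opD θ n (1 / conj w)).range := if_neg hw.not_ge

lemma rangeSpace_infty (n : ℕ) : rangeSpace θ OnePoint.infty n = (opD θ n 0).range := rfl

lemma exists_isJordanChain_rangeSpace (hdim : ¬ FiniteDimensional ℂ (modelSpace θ)) {n : ℕ}
    {w : OnePoint ℂ} (hw : w ∈ admissible θ n) :
    ∃ (q : ℂ × ℂ) (x : ℕ → modelSpace θ),
      IsJordanChain (backwardShift θ : modelSpace θ →ₗ[ℂ] modelSpace θ)
        (evalZero θ : modelSpace θ →ₗ[ℂ] ℂ) (sphereForm w) q n (fun j => innerₛₗ ℂ (x j)) ∧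
      ∀ m ≤ n, rangeSpace θ w m = Submodule.span ℂ (Set.range fun j : Fin (m + 1) => x j) := by
  rcases hw with ⟨w, hw | hw, rfl⟩ | rfl
  · obtain ⟨l, κ, hl, hκ, hop⟩ := exists_representsJet_opDbar hw
    refine ⟨_, κ, hκ.isJordanChain hdim, fun m hm => ?_⟩
    rw [rangeSpace_coe_of_norm_le_one (hw.elim (fun hw => le_of_lt hw) fun hw => hw.1.le), hop m hm,
      (hκ.mono hm).range_leibnizOperator hdim]
  · have hw₀ : -w ≠ 0 := neg_ne_zero.2 (norm_pos_iff.1 (zero_lt_one.trans hw))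
    have hdisk : ‖1 / conj w‖ < 1 := by
      rw [norm_div, norm_one, RCLike.norm_conj]
      exact (div_lt_one (zero_lt_one.trans hw)).2 hw
    have hκ := representsJet_pure (θ := θ) n hdisk
    have hform : -w • ((1 : ℂ), -conj (1 / conj w)) = sphereForm w := by
      simp [sphereForm, mul_inv_cancel₀ (neg_ne_zero.1 hw₀)]
    refine ⟨_, _, hform ▸ (hκ.isJordanChain_conjugation hdim).smul hw₀, fun m hm => ?_⟩
    rw [rangeSpace_coe_of_one_lt_norm hw, opD_eq_leibnizOperator m hdisk,
      (hκ.mono hm).range_leibnizOperator_conjugation hdim]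
  · have hκ := representsJet_pure (θ := θ) n (w := 0) (by simp)
    have hform : ((1 : ℂ), -conj (0 : ℂ)) = sphereForm OnePoint.infty := by simp [sphereForm]
    refine ⟨_, _, hform ▸ hκ.isJordanChain_conjugation hdim, fun m hm => ?_⟩
    rw [rangeSpace_infty, opD_eq_leibnizOperator m (by simp),
      (hκ.mono hm).range_leibnizOperator_conjugation hdim]

lemma finiteDimensional_rangeSpace (hdim : ¬ FiniteDimensional ℂ (modelSpace θ)) {n : ℕ}
    {w : OnePoint ℂ} (hw : w ∈ admissible θ n) : FiniteDimensional ℂ (rangeSpace θ w n) := by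
  obtain ⟨q, x, -, hspan⟩ := exists_isJordanChain_rangeSpace hdim hw
  rw [hspan n le_rfl]
  exact FiniteDimensional.span_of_finite ℂ (Set.finite_range _)

lemma injective_of_iSupIndep_rangeSpace (hdim : ¬ FiniteDimensional ℂ (modelSpace θ))
    {ι : Type*} {w : ι → OnePoint ℂ} {n : ι → ℕ} (hw : ∀ k, w k ∈ admissible θ (n k))
    (hindep : iSupIndep fun k => rangeSpace θ (w k) (n k)) : Function.Injective w := by
  intro k l hkl
  by_contra hne
  wlog hn : n k ≤ n l generalizing k l
  · exact this hkl.symm (Ne.symm hne) (le_of_not_ge hn)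
  obtain ⟨q, x, hx, hspan⟩ := exists_isJordanChain_rangeSpace hdim (hw l)
  have hmem : ∀ m ≤ n l, x 0 ∈ rangeSpace θ (w l) m := fun m hm => by
    rw [hspan m hm]
    exact Submodule.subset_span ⟨0, rfl⟩
  have hx₀ : x 0 = 0 := Submodule.disjoint_def.1 (hindep.pairwiseDisjoint hne) (x 0)
    (by simpa only [hkl] using hmem _ hn) (hmem _ le_rfl)
  exact hx.zero_ne_zero (by rw [hx₀, map_zero])

/-! ### Components of an operator along a direct sum -/

lemma innerₛₗ_mem_span {𝕜 H ι : Type*} [RCLike 𝕜] [NormedAddCommGroup H] [InnerProductSpace 𝕜 H]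
    {x : ι → H} {y : H} (hy : y ∈ Submodule.span 𝕜 (Set.range x)) :
    innerₛₗ 𝕜 y ∈ Submodule.span 𝕜 (Set.range fun j => innerₛₗ 𝕜 (x j)) := by
  have hmap := Submodule.mem_map_of_mem (f := innerₛₗ 𝕜) hy
  rwa [Submodule.map_span, ← Set.range_comp] at hmap

lemma ShiftInvariant.of_sum (hdim : ¬ FiniteDimensional ℂ (modelSpace θ)) {ι : Type*} [Fintype ι]
    {w : ι → OnePoint ℂ} (hw : Function.Injective w) {n : ι → ℕ}
    (hadm : ∀ k, w k ∈ admissible θ (n k)) {B : ι → modelSpace θ →L[ℂ] modelSpace θ}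
    (hB : ∀ k, (B k).range ≤ rangeSpace θ (w k) (n k)) (hsum : ShiftInvariant (∑ k, B k))
    (k : ι) : ShiftInvariant (B k) := by
  choose q x hx hspan using fun k => exists_isJordanChain_rangeSpace hdim (hadm k)
  have hmem : ∀ f k, innerₛₗ ℂ (B k f) ∈
      Submodule.span ℂ (Set.range fun j : Fin (n k + 1) => innerₛₗ ℂ (x k j)) := fun f k =>
    innerₛₗ_mem_span (hspan k (n k) le_rfl ▸ hB k ⟨f, rfl⟩)
  intro f g hf hg
  have hzero : ∀ g ∈ LinearMap.ker (evalZero θ : modelSpace θ →ₗ[ℂ] ℂ),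
      ∑ k, innerₛₗ ℂ (B k f) g =
        ∑ k, innerₛₗ ℂ (B k (backwardShift θ f)) (backwardShift θ g) := fun g hg => by
    simpa [sum_inner, inner_conj_symm (𝕜 := ℂ)] using congrArg conj (hsum f g hf hg)
  have hBk := (isObservable_backwardShift θ).apply_eq_apply_of_sum_eq hdim hx
    (fun k l hkl => det_sphereForm_ne_zero (hw.ne hkl)) (hmem f) (hmem (backwardShift θ f))
    hzero k g hg
  simpa [inner_conj_symm (𝕜 := ℂ)] using congrArg conj hBk

lemma exists_projections_of_iSupIndep {𝕜 V ι : Type*} [Field 𝕜] [AddCommGroup V] [Module 𝕜 V]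
    {F : ι → Submodule 𝕜 V} (h : iSupIndep F) :
    ∃ π : ι → Module.End 𝕜 V, (∀ k v, π k v ∈ F k) ∧ (∀ k, ∀ v ∈ F k, π k v = v) ∧
      ∀ k l, k ≠ l → ∀ v ∈ F l, π k v = 0 := by
  classical
  obtain ⟨P, hP⟩ := LinearMap.exists_leftInverse_of_injective
    (DFinsupp.lsum ℕ fun k => (F k).subtype) (LinearMap.ker_eq_bot.2 h.dfinsupp_lsum_injective)
  have hsingle : ∀ l (v : F l), P v = DFinsupp.single l v := fun l v => by
    simpa using LinearMap.congr_fun hP (DFinsupp.single l v)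
  refine ⟨fun k => (F k).subtype ∘ₗ DFinsupp.lapply k ∘ₗ P, fun k v => (P v k).2, fun k v hv => ?_,
    fun k l hkl v hv => ?_⟩
  · simp [hsingle k ⟨v, hv⟩]
  · simp [hsingle l ⟨v, hv⟩, DFinsupp.single_eq_of_ne hkl]

lemma exists_sum_eq_of_range_eq_iSup {𝕜 E H ι : Type*} [NontriviallyNormedField 𝕜]
    [CompleteSpace 𝕜] [NormedAddCommGroup E] [NormedSpace 𝕜 E] [NormedAddCommGroup H]
    [NormedSpace 𝕜 H] [Fintype ι] {A : E →L[𝕜] H} {F : ι → Submodule 𝕜 H}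
    [∀ k, FiniteDimensional 𝕜 (F k)] (hindep : iSupIndep F) (hrange : A.range = ⨆ k, F k) :
    ∃ B : ι → E →L[𝕜] H, (∀ k, (B k).range = F k) ∧ A = ∑ k, B k := by
  obtain ⟨π, hπmem, hπself, hπother⟩ := exists_projections_of_iSupIndep hindep
  have hA : ∀ f, A f ∈ ⨆ k, F k := fun f => hrange ▸ ⟨f, rfl⟩
  let B : ι → E →L[𝕜] H := fun k =>
    (LinearMap.toContinuousLinearMap (π k ∘ₗ (⨆ k, F k).subtype)).comp (A.codRestrict _ hA)
  have hBapply : ∀ k f, B k f = π k (A f) := fun _ _ => rfl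
  have hπsum : ⨆ k, F k ≤ LinearMap.eqLocus (∑ k, π k) LinearMap.id := iSup_le fun l v hv => by
    rw [LinearMap.mem_eqLocus, LinearMap.sum_apply,
      Fintype.sum_eq_single l fun k hkl => hπother k l hkl v hv, hπself l v hv, LinearMap.id_apply]
  refine ⟨B, fun k => le_antisymm ?_ fun v hv => ?_, ?_⟩
  · rintro _ ⟨f, rfl⟩
    exact hπmem k (A f)
  · obtain ⟨f, rfl⟩ : v ∈ A.range := hrange ▸ Submodule.mem_iSup_of_mem k hv
    exact ⟨f, hπself k _ hv⟩
  · ext f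
    simpa [hBapply] using (hπsum (hA f)).symm

end

end TruncatedToeplitz

open TruncatedToeplitz in
theorem mainTheorem3 (θ : TruncatedToeplitz.InnerFunction)
    (hdim : ¬ FiniteDimensional ℂ (TruncatedToeplitz.modelSpace θ))
    (A : TruncatedToeplitz.modelSpace θ →L[ℂ] TruncatedToeplitz.modelSpace θ)
    (hA : TruncatedToeplitz.IsTruncatedToeplitz θ A)
    (s : ℕ) (lam : Fin s → OnePoint ℂ) (n : Fin s → ℕ)
    (hlam : ∀ k, lam k ∈ TruncatedToeplitz.admissible θ (n k))
    (hindep : iSupIndep fun k => TruncatedToeplitz.rangeSpace θ (lam k) (n k))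
    (hrange : A.range = ⨆ k, TruncatedToeplitz.rangeSpace θ (lam k) (n k)) :
    ∃ B : Fin s → (TruncatedToeplitz.modelSpace θ →L[ℂ] TruncatedToeplitz.modelSpace θ),
      (∀ k, TruncatedToeplitz.IsTruncatedToeplitz θ (B k)) ∧
      (∀ k, (B k).range = TruncatedToeplitz.rangeSpace θ (lam k) (n k)) ∧
      A = ∑ k, B k := by
  have := fun k => finiteDimensional_rangeSpace hdim (hlam k)
  obtain ⟨B, hB, rfl⟩ := exists_sum_eq_of_range_eq_iSup hindep hrange
  obtain ⟨b, hb⟩ := exists_evalZero_eq_one hdim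
  have hinj := injective_of_iSupIndep_rangeSpace hdim hlam hindep
  have hBshift : ∀ k, ShiftInvariant (B k) :=
    ShiftInvariant.of_sum hdim hinj hlam (fun k => (hB k).le) hA.shiftInvariant
  exact ⟨B, fun k => (hBshift k).isTruncatedToeplitz hb, hB, rfl⟩
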